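/- Consider a Raptor code ensemble written as a multi-edge-type LDPC ensemble with three edge types. Type 1 belongs to the LDPC precode, type 2 to the LT code, and type 3 joins each output bit to its own check node. Relative to the number of output bits, let $L_{[i\,j]}\ge 0$ ($2\le i\le i_{\max}$, $1\le j\le j_{\max}$) be the fraction of punctured input bit nodes with $i$ edges of type 1 and $j$ edges of type 2. Let $R_i\ge 0$ ($i\ge1$, finitely many) be the fraction of precode check nodes of degree $i$, and $\Omega_j\ge 0$ ($j\ge1$, finitely many, $\sum_j\Omega_j=1$) the fraction of LT check nodes with $j$ edges of type 2. Every LT check node has one edge of type 3, and every output bit node has that edge only. Assume the socket equalities $\sum_{i,j} iL_{[i\,j]}=\sum_i iR_i$ and $\sum_{i,j} jL_{[i\,j]}=\sum_j j\Omega_j$. Put $$\lambda_{[i\,j]}=\frac{iL_{[i\,j]}}{\sum_{i',j'}i'L_{[i'\,j']}},\qquad \rho_i=\frac{iR_i}{\sum_{i'}i'R_{i'}},\qquad \rho_1(x)=\sum_{i}\rho_i\,x^{i-1}.$$ The output bits are sent over a BI-AWGN channel of noise variance $\sigma^2>0$. Let $a_0$ be the density of the channel log-likelihood ratio under the all-zero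 codeword (Gaussian with mean $2/\sigma^2$ and variance $4/\sigma^2$), and let $x_0=\int e^{-x/2}a_0(dx)$ be its Bhattacharyya constant. The code is decoded jointly by belief propagation. Let $(a_1^{(\ell)},a_2^{(\ell)})$ be the densities of the variable-to-check messages on edges of types 1 and 2 (on type 3 the density is always $a_0$), evolving by multi-edge-type density evolution on the whole graph. Write $P_e(a)=a(\{x<0\})+\tfrac12a(\{0\})$ for the error probability of a density $a$ on $[-\infty,\infty]$, and $\Delta_\infty$ for the point mass at $+\infty$. If $$\Big(\sum_{j\ge1}\lambda_{[2\,j]}\,x_0^{\,j}\Big)\,\rho_1'(1)<1,$$ then the zero-error fixed point $(a_1,a_2)=(\Delta_\infty,\Delta_\infty)$ is stable. That is: 1. It is a fixed point of density evolution. 2. For every $\varepsilon>0$ there is $\xi>0$ such that if density evolution is started from symmetric densities $a_1^{(0)},a_2^{(0)}$ with error probabilities at most $\xi$, then $P_e(a_1^{(\ell)})\le\varepsilon$ and $P_e(a_2^{(\ell)})\le\varepsilon$ for all $\ell$. 3. There is $\xi>0$ such that, from every such start, $a_1^{(\ell)}$ and $a_2^{(\ell)}$ converge weakly to $\Delta_\infty$,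 and the bit error rates of the input bits and of the output bits tend to $0$ as $\ell\to\infty$. In particular, there is $\xi>0$ such that if the joint decoder, started from uninformative messages of the punctured input bits, reaches $P_e(a_1^{(\ell)})\le\xi$ at some iteration $\ell$, then the bit error rates of its input and output bits tend to $0$ as $\ell\to\infty$. -/

import Mathlib

open MeasureTheory ProbabilityTheory Filter Topology Finset
open scoped NNReal ENNReal

noncomputable section

namespace RaptorMET

/-! ### Message densities

A message is a log-likelihood ratio in `[-∞, +∞]`, and its density is a measure on `EReal`.
`Measure.dirac ⊤` is the density of an error-free message, `Measure.dirac 0` that of an erased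
(uninformative) one. Messages are described under the all-zero codeword, so that a negative
message is an error. -/

/-- `tanh (x / 2)`, extended to `[-∞, +∞]`. -/
def tanhHalf : EReal → ℝ
  | ⊤ => 1
  | ⊥ => -1
  | (x : ℝ) => Real.tanh (x / 2)

/-- `2 * artanh t`, extended to `[-1, 1]`: the inverse of `tanhHalf`. -/
def twoArtanh (t : ℝ) : EReal :=
  if 1 ≤ t then ⊤ else if t ≤ -1 then ⊥ else ((2 * Real.artanh t : ℝ) : EReal)

/-- The belief propagation rule at a check node, for two incoming messages. -/
def boxPlus (x y : EReal) : EReal := twoArtanh (tanhHalf x * tanhHalf y)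

/-- Variable node convolution: the density of the sum of two independent messages. -/
def varConv (a b : Measure EReal) : Measure EReal := a ∗ b

/-- Check node convolution: the density of the check rule applied to two independent messages. -/
def checkConv (a b : Measure EReal) : Measure EReal :=
  (a.prod b).map fun p => boxPlus p.1 p.2

/-- The `n`-fold variable node convolution. -/
def varPow (a : Measure EReal) : ℕ → Measure EReal
  | 0 => Measure.dirac 0
  | n + 1 => varConv a (varPow a n)

/-- The `n`-fold check node convolution. -/
def checkPow (a : Measure EReal) : ℕ → Measure EReal
  | 0 => Measure.dirac ⊤
  | n + 1 => checkConv a (checkPow a n)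

/-- A symmetric message density: a probability measure on `(-∞, +∞]` with
`a(-dx) = exp(-x) a(dx)` on the finite part. -/
structure IsSymmetricDensity (a : Measure EReal) : Prop where
  isProbabilityMeasure : IsProbabilityMeasure a
  bot_null : a {⊥} = 0
  symm : (a.comap Real.toEReal).map (fun x => -x) =
    (a.comap Real.toEReal).withDensity fun x => ENNReal.ofReal (Real.exp (-x))

/-- The bit error probability of a message density (a message `0` is decided by a fair coin). -/
def errorProb (a : Measure EReal) : ℝ := a.real (Set.Iio 0) + a.real {0} / 2

/-- Weak convergence of a sequence of message densities. -/
def WeaklyTendsto (a : ℕ → Measure EReal) (b : Measure EReal) : Prop :=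
  ∀ f : BoundedContinuousFunction EReal ℝ,
    Tendsto (fun n => ∫ x, f x ∂(a n)) atTop (𝓝 (∫ x, f x ∂b))

/-! ### The BI-AWGN channel -/

/-- The law of the channel log-likelihood ratio `2 y / σ ^ 2` for noise variance `σ ^ 2`, where
`y` is Gaussian with mean `1` and variance `σ ^ 2`: the symmetric Gaussian law of mean `2 / σ ^ 2`
and variance `4 / σ ^ 2`. -/
def channelLLR (σ : ℝ) : Measure ℝ := gaussianReal (2 / σ ^ 2) (4 / σ ^ 2).toNNReal

/-- The channel message density `a₀`. -/
def channel (σ : ℝ) : Measure EReal := (channelLLR σ).map Real.toEReal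

/-- The Bhattacharyya constant of the channel message: `x₀ = ∫ exp(-x/2) a₀(dx)`. -/
def channelBhattacharyya (σ : ℝ) : ℝ := ∫ x, Real.exp (-x / 2) ∂(channelLLR σ)

/-! ### Raptor codes as multi-edge-type LDPC ensembles -/

/-- A Raptor code ensemble with three edge types: type 1 belongs to the LDPC precode, type 2 to the
LT code, and type 3 joins each output bit to its own check node. All fractions are relative to the
number of output bits.

* `L i j` is the fraction of (punctured) input bit nodes with `i` edges of type 1 and `j` of type 2,
  for `2 ≤ i ≤ ivMax` and `1 ≤ j ≤ jvMax`;
* `R i` is the fraction of precode check nodes with `i` edges of type 1, for `1 ≤ i ≤ icMax`;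
* `Ω j` is the fraction of check nodes with `j` edges of type 2 and one edge of type 3,
  for `1 ≤ j ≤ jcMax`;
* the output bit nodes have one edge of type 3 and no other edge; their fraction is `1`.

Values of `L`, `R`, `Ω` outside of these ranges are never used. -/
structure Ensemble where
  ivMax : ℕ
  jvMax : ℕ
  icMax : ℕ
  jcMax : ℕ
  L : ℕ → ℕ → ℝ≥0
  R : ℕ → ℝ≥0
  Ω : ℕ → ℝ≥0
  /-- There is one LT check node for each output bit (socket equality for type 3). -/
  sum_Ω : ∑ j ∈ Icc 1 jcMax, Ω j = 1
  /-- Socket equality for type 1. -/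
  socket₁ : ∑ i ∈ Icc 2 ivMax, ∑ j ∈ Icc 1 jvMax, (i : ℝ≥0) * L i j =
    ∑ i ∈ Icc 1 icMax, (i : ℝ≥0) * R i
  /-- Socket equality for type 2. -/
  socket₂ : ∑ i ∈ Icc 2 ivMax, ∑ j ∈ Icc 1 jvMax, (j : ℝ≥0) * L i j =
    ∑ j ∈ Icc 1 jcMax, (j : ℝ≥0) * Ω j

namespace Ensemble

variable (C : Ensemble)

/-- The fraction `λ_[i j]` of type 1 edges at input bit nodes of type `[i j]`. -/
def lam (i j : ℕ) : ℝ≥0 :=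
  (i : ℝ≥0) * C.L i j / ∑ i' ∈ Icc 2 C.ivMax, ∑ j' ∈ Icc 1 C.jvMax, (i' : ℝ≥0) * C.L i' j'

/-- The fraction `ρ_i` of type 1 edges at precode check nodes of degree `i`. -/
def rho (i : ℕ) : ℝ≥0 :=
  (i : ℝ≥0) * C.R i / ∑ i' ∈ Icc 1 C.icMax, (i' : ℝ≥0) * C.R i'

/-- The polynomial `ρ₁(x) = ∑ ρ_i x ^ (i - 1)`. -/
def rhoPoly (x : ℝ) : ℝ := ∑ i ∈ Icc 1 C.icMax, (C.rho i : ℝ) * x ^ (i - 1)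

/-- The fraction of type 2 edges at input bit nodes of type `[i j]`. -/
def lamLT (i j : ℕ) : ℝ≥0 :=
  (j : ℝ≥0) * C.L i j / ∑ i' ∈ Icc 2 C.ivMax, ∑ j' ∈ Icc 1 C.jvMax, (j' : ℝ≥0) * C.L i' j'

/-- The fraction of type 2 edges at LT check nodes with `j` edges of type 2. -/
def rhoLT (j : ℕ) : ℝ≥0 :=
  (j : ℝ≥0) * C.Ω j / ∑ j' ∈ Icc 1 C.jcMax, (j' : ℝ≥0) * C.Ω j'

/-! ### Multi-edge-type density evolution for joint decoding

The state after a half-iteration is the pair `(a₁, a₂)` of the variable-to-check densities on the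
edges of types 1 and 2. The variable-to-check density on type 3 is always the channel density,
because output bit nodes have degree one. -/

/-- Check-to-variable density on type 1. -/
def checkOut₁ (s : Measure EReal × Measure EReal) : Measure EReal :=
  ∑ i ∈ Icc 1 C.icMax, C.rho i • checkPow s.1 (i - 1)

/-- Check-to-variable density on type 2. -/
def checkOut₂ (σ : ℝ) (s : Measure EReal × Measure EReal) : Measure EReal :=
  checkConv (channel σ) (∑ j ∈ Icc 1 C.jcMax, C.rhoLT j • checkPow s.2 (j - 1))

/-- Check-to-variable density on type 3. -/
def checkOut₃ (s : Measure EReal × Measure EReal) : Measure EReal :=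
  ∑ j ∈ Icc 1 C.jcMax, C.Ω j • checkPow s.2 j

/-- Variable-to-check density on type 1, from the check-to-variable densities `b₁`, `b₂`
(input bits are punctured and have no channel message). -/
def varOut₁ (b₁ b₂ : Measure EReal) : Measure EReal :=
  ∑ i ∈ Icc 2 C.ivMax, ∑ j ∈ Icc 1 C.jvMax,
    C.lam i j • varConv (varPow b₁ (i - 1)) (varPow b₂ j)

/-- Variable-to-check density on type 2, from the check-to-variable densities `b₁`, `b₂`. -/
def varOut₂ (b₁ b₂ : Measure EReal) : Measure EReal :=
  ∑ i ∈ Icc 2 C.ivMax, ∑ j ∈ Icc 1 C.jvMax,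
    C.lamLT i j • varConv (varPow b₁ i) (varPow b₂ (j - 1))

/-- One full iteration of density evolution. -/
def step (σ : ℝ) (s : Measure EReal × Measure EReal) : Measure EReal × Measure EReal :=
  (C.varOut₁ (C.checkOut₁ s) (C.checkOut₂ σ s), C.varOut₂ (C.checkOut₁ s) (C.checkOut₂ σ s))

/-- The densities of the joint decoder after `ℓ` iterations; the first messages of the punctured
input bits are uninformative. -/
def decoder (σ : ℝ) (ℓ : ℕ) : Measure EReal × Measure EReal :=
  (C.step σ)^[ℓ] (Measure.dirac 0, Measure.dirac 0)

/-- The average bit error rate of the input bits, each decided from the sum of all its incoming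
messages. -/
def inputBER (σ : ℝ) (s : Measure EReal × Measure EReal) : ℝ :=
  (∑ i ∈ Icc 2 C.ivMax, ∑ j ∈ Icc 1 C.jvMax, (C.L i j : ℝ) *
      errorProb (varConv (varPow (C.checkOut₁ s) i) (varPow (C.checkOut₂ σ s) j))) /
    ∑ i ∈ Icc 2 C.ivMax, ∑ j ∈ Icc 1 C.jvMax, (C.L i j : ℝ)

/-- The bit error rate of the output bits, each decided from its channel message and its incoming
message. -/
def outputBER (σ : ℝ) (s : Measure EReal × Measure EReal) : ℝ :=
  errorProb (varConv (channel σ) (C.checkOut₃ s))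

/-- The zero-error point: all messages of the input bits are error-free. -/
def zeroErrorPoint : Measure EReal × Measure EReal := (Measure.dirac ⊤, Measure.dirac ⊤)

/-- Stability of the zero-error fixed point of density evolution for the full graph: it is a fixed
point, it is Lyapunov stable, and it attracts all symmetric states near it, with vanishing bit error
rates. The distance of a symmetric state from the zero-error point is measured by the error
probabilities of its two components. -/
structure ZeroErrorStable (σ : ℝ) : Prop where
  fixed : C.step σ zeroErrorPoint = zeroErrorPoint
  lyapunov : ∀ ε : ℝ, 0 < ε → ∃ ξ : ℝ, 0 < ξ ∧ ∀ s : Measure EReal × Measure EReal,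
    IsSymmetricDensity s.1 → IsSymmetricDensity s.2 → errorProb s.1 ≤ ξ → errorProb s.2 ≤ ξ →
      ∀ ℓ : ℕ, errorProb ((C.step σ)^[ℓ] s).1 ≤ ε ∧ errorProb ((C.step σ)^[ℓ] s).2 ≤ ε
  attracting : ∃ ξ : ℝ, 0 < ξ ∧ ∀ s : Measure EReal × Measure EReal,
    IsSymmetricDensity s.1 → IsSymmetricDensity s.2 → errorProb s.1 ≤ ξ → errorProb s.2 ≤ ξ →
      WeaklyTendsto (fun ℓ => ((C.step σ)^[ℓ] s).1) (Measure.dirac ⊤) ∧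
      WeaklyTendsto (fun ℓ => ((C.step σ)^[ℓ] s).2) (Measure.dirac ⊤) ∧
      Tendsto (fun ℓ => C.inputBER σ ((C.step σ)^[ℓ] s)) atTop (𝓝 0) ∧
      Tendsto (fun ℓ => C.outputBER σ ((C.step σ)^[ℓ] s)) atTop (𝓝 0)

end Ensemble

end RaptorMET

end

noncomputable section

namespace RaptorMET

/-! ### The functions `tanhHalf`, `twoArtanh` and `boxPlus` -/

/-! Density evolution is reduced to two real numbers, the Bhattacharyya functionals `x`, `y` of the
densities on types 1 and 2. The functional is multiplicative under variable node convolution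
(`bhattacharyya_varConv`) and, on symmetric densities, subadditive under check node convolution
(`IsBSCMixture.bhattacharyya_checkConv_le`). The check-to-variable values therefore satisfy `u ≤
ρ₁'(1) x` and `v ≤ x₀ + M y`, with `M` the mean of `j - 1` under `rhoLT`. Only input bits with two
precode edges pass `u` on to first order: the new `x` is at most `(∑ λ_[2 j] v ^ j) u + u ^ 2`, and
the new `y` is at most `u ^ 2`. Near zero both are at most `q x`, where `q < 1` can be taken close
to the left side of the stability condition (`exists_contraction`), so both decay geometrically.

Symmetry is used in the form `IsBSCMixture`, invariance under redrawing the sign of a message. It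
lets `exp (-x / 2)` be replaced by its sign average `√(1 - tanh (x / 2) ^ 2)`, for which the check
node inequality holds pointwise, and it survives every operation of density evolution. The same
averaging compares the functional with the error probability in both directions
(`IsBSCMixture.errorProb_le`, `IsBSCMixture.bhattacharyya_le_of_errorProb_le`), so small error
probability is equivalent to small functional. -/

@[simp] lemma tanhHalf_top : tanhHalf ⊤ = 1 := rfl

@[simp] lemma tanhHalf_bot : tanhHalf ⊥ = -1 := rfl

@[simp] lemma tanhHalf_coe (x : ℝ) : tanhHalf (x : EReal) = Real.tanh (x / 2) := rfl

lemma tanhHalf_neg (x : EReal) : tanhHalf (-x) = -tanhHalf x := by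
  induction x with
  | bot => simp
  | top => simp
  | coe x => rw [← EReal.coe_neg, tanhHalf_coe, tanhHalf_coe, neg_div, Real.tanh_neg]

lemma abs_tanhHalf_le_one (x : EReal) : |tanhHalf x| ≤ 1 := by
  induction x with
  | bot => simp
  | top => simp
  | coe x => exact (Real.abs_tanh_lt_one _).le

lemma measurable_tanhHalf : Measurable tanhHalf :=
  EReal.measurable_of_measurable_real <| by
    have : Continuous fun x : ℝ => Real.tanh (x / 2) := by
      simp only [Real.tanh_eq_sinh_div_cosh]
      exact (Real.continuous_sinh.comp (by fun_prop)).div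
        (Real.continuous_cosh.comp (by fun_prop)) fun x => (Real.cosh_pos _).ne'
    exact this.measurable

lemma tanhHalf_twoArtanh {t : ℝ} (ht : |t| ≤ 1) : tanhHalf (twoArtanh t) = t := by
  obtain ⟨h₁, h₂⟩ := abs_le.1 ht
  unfold twoArtanh
  split_ifs with h h'
  · simp; linarith
  · simp; linarith
  · rw [tanhHalf_coe, mul_div_cancel_left₀ _ two_ne_zero,
      Real.tanh_artanh ⟨not_le.1 h', not_le.1 h⟩]

lemma twoArtanh_neg {t : ℝ} (ht : |t| ≤ 1) : twoArtanh (-t) = -twoArtanh t := by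
  obtain ⟨h₁, h₂⟩ := abs_le.1 ht
  unfold twoArtanh
  split_ifs <;> try first | (exfalso; linarith) | simp
  rename_i h₃ h₄ h₅ h₆
  have : Real.artanh (-t) = -Real.artanh t := by
    apply Real.tanh_injective
    rw [Real.tanh_neg, Real.tanh_artanh ⟨not_le.1 h₄, not_le.1 h₃⟩,
      Real.tanh_artanh ⟨not_le.1 h₆, not_le.1 h₅⟩]
  rw [this]
  norm_cast
  ring

lemma measurable_twoArtanh : Measurable twoArtanh := by
  unfold twoArtanh
  refine Measurable.ite measurableSet_Ici measurable_const
    (Measurable.ite measurableSet_Iic measurable_const ?_)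
  refine Measurable.coe_real_ereal ?_
  unfold Real.artanh
  fun_prop

lemma abs_tanhHalf_mul_le (x y : EReal) : |tanhHalf x * tanhHalf y| ≤ 1 := by
  rw [abs_mul]
  exact mul_le_one₀ (abs_tanhHalf_le_one x) (abs_nonneg _) (abs_tanhHalf_le_one y)

lemma tanhHalf_boxPlus (x y : EReal) : tanhHalf (boxPlus x y) = tanhHalf x * tanhHalf y :=
  tanhHalf_twoArtanh (abs_tanhHalf_mul_le x y)

lemma boxPlus_neg_left (x y : EReal) : boxPlus (-x) y = -boxPlus x y := by
  rw [boxPlus, tanhHalf_neg, neg_mul, twoArtanh_neg (abs_tanhHalf_mul_le x y), boxPlus]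

lemma boxPlus_neg_right (x y : EReal) : boxPlus x (-y) = -boxPlus x y := by
  rw [boxPlus, tanhHalf_neg, mul_neg, twoArtanh_neg (abs_tanhHalf_mul_le x y), boxPlus]

lemma measurable_boxPlus : Measurable fun p : EReal × EReal => boxPlus p.1 p.2 :=
  measurable_twoArtanh.comp <|
    (measurable_tanhHalf.comp measurable_fst).mul (measurable_tanhHalf.comp measurable_snd)

@[fun_prop] lemma measurable_boxPlus_right (x : EReal) : Measurable (boxPlus x) :=
  measurable_boxPlus.comp measurable_prodMk_left

/-! ### Weights on the extended real line -/

/-- The probability that a bit with log-likelihood ratio `x` is `0`. -/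
def probZero (x : EReal) : ℝ≥0∞ := ENNReal.ofReal ((1 + tanhHalf x) / 2)

lemma probZero_neg (x : EReal) : probZero (-x) = ENNReal.ofReal ((1 - tanhHalf x) / 2) := by
  rw [probZero, tanhHalf_neg, sub_eq_add_neg]

lemma half_one_add_tanhHalf_nonneg (x : EReal) : 0 ≤ (1 + tanhHalf x) / 2 := by
  linarith [(abs_le.1 (abs_tanhHalf_le_one x)).1]

lemma half_one_sub_tanhHalf_nonneg (x : EReal) : 0 ≤ (1 - tanhHalf x) / 2 := by
  linarith [(abs_le.1 (abs_tanhHalf_le_one x)).2]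

lemma probZero_add_probZero_neg (x : EReal) : probZero x + probZero (-x) = 1 := by
  rw [probZero_neg, probZero, ← ENNReal.ofReal_add (half_one_add_tanhHalf_nonneg x)
    (half_one_sub_tanhHalf_nonneg x)]
  ring_nf
  simp

@[fun_prop] lemma measurable_probZero : Measurable probZero :=
  ENNReal.measurable_ofReal.comp ((measurable_tanhHalf.const_add 1).div_const 2)

lemma probZero_boxPlus (x y : EReal) :
    probZero (boxPlus x y) = probZero x * probZero y + probZero (-x) * probZero (-y) := by
  rw [probZero_neg, probZero_neg, probZero, probZero, probZero, tanhHalf_boxPlus,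
    ← ENNReal.ofReal_mul (half_one_add_tanhHalf_nonneg x),
    ← ENNReal.ofReal_mul (half_one_sub_tanhHalf_nonneg x),
    ← ENNReal.ofReal_add (mul_nonneg (half_one_add_tanhHalf_nonneg x)
      (half_one_add_tanhHalf_nonneg y)) (mul_nonneg (half_one_sub_tanhHalf_nonneg x)
      (half_one_sub_tanhHalf_nonneg y))]
  ring_nf

/-- The weight `exp (-c x)` on finite messages, and `0` on infinite ones. -/
def expWeight (c : ℝ) : EReal → ℝ≥0∞
  | ⊤ => 0
  | ⊥ => 0
  | (x : ℝ) => ENNReal.ofReal (Real.exp (-(c * x)))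

@[simp] lemma expWeight_top (c : ℝ) : expWeight c ⊤ = 0 := rfl

@[simp] lemma expWeight_bot (c : ℝ) : expWeight c ⊥ = 0 := rfl

@[simp] lemma expWeight_coe (c x : ℝ) :
    expWeight c (x : EReal) = ENNReal.ofReal (Real.exp (-(c * x))) := rfl

@[fun_prop] lemma measurable_expWeight (c : ℝ) : Measurable (expWeight c) :=
  EReal.measurable_of_measurable_real <| by
    simp only [expWeight_coe]
    fun_prop

/-- Weight `0` at both infinities keeps this valid without exception, including `⊤ + ⊥ = ⊥`. -/
lemma expWeight_add (c : ℝ) (x y : EReal) :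
    expWeight c (x + y) = expWeight c x * expWeight c y := by
  induction x with
  | bot => simp
  | top => induction y with
    | bot => simp
    | top => simp
    | coe y => simp
  | coe x => induction y with
    | bot => simp
    | top => simp
    | coe y =>
      rw [← EReal.coe_add, expWeight_coe, expWeight_coe, expWeight_coe,
        ← ENNReal.ofReal_mul (Real.exp_pos _).le, ← Real.exp_add]
      ring_nf

lemma expWeight_zero_neg (x : EReal) : expWeight 0 (-x) = expWeight 0 x := by
  induction x with
  | bot => simp
  | top => simp
  | coe x => rw [← EReal.coe_neg, expWeight_coe, expWeight_coe]; simp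

lemma exp_neg_mul_one_add_tanh (y : ℝ) :
    Real.exp (-(2 * y)) * (1 + Real.tanh y) = 1 - Real.tanh y := by
  have hc := (Real.cosh_pos y).ne'
  have h : Real.exp (-(2 * y)) = Real.exp (-y) / Real.exp y := by
    rw [← Real.exp_sub]; ring_nf
  rw [h, Real.tanh_eq_sinh_div_cosh]
  have h₁ : 1 + Real.sinh y / Real.cosh y = Real.exp y / Real.cosh y := by
    rw [← Real.cosh_add_sinh]; field_simp
  have h₂ : 1 - Real.sinh y / Real.cosh y = Real.exp (-y) / Real.cosh y := by
    rw [← Real.cosh_sub_sinh]; field_simp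
  rw [h₁, h₂]
  have := (Real.exp_pos y).ne'
  field_simp

/-- For finite `x`, `exp (-x)` is the posterior odds of bit `1` against bit `0`. The factor
`expWeight 0` is the indicator of finite messages. -/
lemma expWeight_one_mul_probZero (x : EReal) :
    expWeight 1 x * probZero x = expWeight 0 x * probZero (-x) := by
  induction x with
  | bot => simp
  | top => simp
  | coe x =>
    rw [probZero_neg, probZero, expWeight_coe, expWeight_coe,
      ← ENNReal.ofReal_mul (Real.exp_pos _).le, ← ENNReal.ofReal_mul (Real.exp_pos _).le,
      tanhHalf_coe]
    have := exp_neg_mul_one_add_tanh (x / 2)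
    rw [mul_div_cancel₀ x two_ne_zero] at this
    congr 1
    simp only [one_mul, zero_mul, neg_zero, Real.exp_zero]
    linear_combination this / 2

/-! ### Symmetric densities as mixtures of binary symmetric channels -/

/-- A probability measure that is invariant under redrawing the sign of a message from its
a posteriori distribution. -/
structure IsBSCMixture (a : Measure EReal) : Prop where
  isProbabilityMeasure : IsProbabilityMeasure a
  lintegral_eq : ∀ f : EReal → ℝ≥0∞, Measurable f →
    ∫⁻ x, f x ∂a = ∫⁻ x, (probZero x * f x + probZero (-x) * f (-x)) ∂a

/-- Redrawing the sign of an infinite message yields `⊤` with certainty, so `⊥` never occurs. -/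
lemma IsBSCMixture.bot_null {a : Measure EReal} (ha : IsBSCMixture a) : a {⊥} = 0 := by
  have h := ha.lintegral_eq (Set.indicator {⊥} 1)
    (measurable_one.indicator (measurableSet_singleton _))
  rw [lintegral_indicator_one (measurableSet_singleton _)] at h
  rw [h]
  refine (lintegral_congr fun x => ?_).trans lintegral_zero
  induction x with
  | bot => simp [probZero]
  | top => simp [probZero]
  | coe x => rw [← EReal.coe_neg]; simp

lemma IsBSCMixture.lintegral_expWeight {a : Measure EReal} (ha : IsBSCMixture a)
    {f : EReal → ℝ≥0∞} (hf : Measurable f) :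
    ∫⁻ x, expWeight 0 x * f (-x) ∂a = ∫⁻ x, expWeight 1 x * f x ∂a := by
  rw [ha.lintegral_eq (fun x => expWeight 0 x * f (-x)) (by fun_prop),
    ha.lintegral_eq (fun x => expWeight 1 x * f x) (by fun_prop)]
  refine lintegral_congr fun x => ?_
  have h₁ := expWeight_one_mul_probZero x
  have h₂ := expWeight_one_mul_probZero (-x)
  rw [neg_neg, expWeight_zero_neg] at h₂
  rw [expWeight_zero_neg, neg_neg]
  calc _ = (expWeight 0 x * probZero (-x)) * f x + (expWeight 0 x * probZero x) * f (-x) := by ring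
    _ = _ := by rw [← h₁, ← h₂]; ring

/-- Converse of `IsBSCMixture.lintegral_expWeight`. Redrawing fixes the atom at `⊤`, so only the
finite part needs the exponential tilt. Of the two forms, the tilt suits sums of messages and the
redrawing suits the check rule. -/
lemma isBSCMixture_of_lintegral_expWeight {a : Measure EReal} (hp : IsProbabilityMeasure a)
    (hbot : a {⊥} = 0) (h : ∀ f : EReal → ℝ≥0∞, Measurable f →
      ∫⁻ x, expWeight 0 x * f (-x) ∂a = ∫⁻ x, expWeight 1 x * f x ∂a) : IsBSCMixture a := by
  refine ⟨hp, fun f hf => ?_⟩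
  have hfin : ∀ᵐ x ∂a, x ≠ ⊥ := by
    rw [ae_iff]; simpa using hbot
  have hsplit : ∀ g : EReal → ℝ≥0∞, Measurable g → ∫⁻ x, g x ∂a =
      ∫⁻ x, Set.indicator {⊤} g x ∂a + ∫⁻ x, expWeight 0 x * g x ∂a := by
    intro g hg
    rw [← lintegral_add_left (hg.indicator (measurableSet_singleton _))]
    refine lintegral_congr_ae (hfin.mono fun x hx => ?_)
    induction x with
    | bot => exact absurd rfl hx
    | top => simp
    | coe x => simp
  -- The tilt turns the reflected term into one with weight `exp (-x) * probZero x = probZero (-x)`,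
  -- which complements `probZero x` to `1`.
  have key := h (fun x => probZero x * f x) (by fun_prop)
  have e₁ : ∫⁻ x, expWeight 0 x * (probZero x * f x + probZero (-x) * f (-x)) ∂a =
      ∫⁻ x, expWeight 0 x * f x ∂a := by
    simp only [mul_add]
    rw [lintegral_add_left (by fun_prop), key, ← lintegral_add_left (by fun_prop)]
    refine lintegral_congr fun x => ?_
    rw [← mul_assoc (expWeight 1 x), expWeight_one_mul_probZero, mul_assoc, ← mul_add, ← add_mul,
      probZero_add_probZero_neg, one_mul]
  rw [hsplit f hf, hsplit (fun x => probZero x * f x + probZero (-x) * f (-x)) (by fun_prop), e₁]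
  congr 1
  refine lintegral_congr fun x => ?_
  by_cases hx : x = ⊤
  · subst hx; simp [probZero]
  · simp [hx]

lemma lintegral_expWeight_zero_mul (a : Measure EReal) (g : EReal → ℝ≥0∞) :
    ∫⁻ x, expWeight 0 x * g x ∂a = ∫⁻ x : ℝ, g x ∂(a.comap Real.toEReal) := by
  have he := EReal.measurableEmbedding_coe
  rw [← he.lintegral_map, he.map_comap, ← lintegral_indicator he.measurableSet_range]
  refine lintegral_congr fun x => ?_
  induction x with
  | bot => simp
  | top => simp
  | coe x => simp

lemma expWeight_one_eq (x : EReal) : expWeight 1 x = expWeight 0 x * expWeight 1 x := by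
  induction x with
  | bot => simp
  | top => simp
  | coe x => simp

lemma IsSymmetricDensity.isBSCMixture {a : Measure EReal} (ha : IsSymmetricDensity a) :
    IsBSCMixture a := by
  refine isBSCMixture_of_lintegral_expWeight ha.isProbabilityMeasure ha.bot_null fun f hf => ?_
  have h₁ : ∫⁻ x, expWeight 1 x * f x ∂a = ∫⁻ x, expWeight 0 x * (expWeight 1 x * f x) ∂a := by
    refine lintegral_congr fun x => ?_
    rw [← mul_assoc, ← expWeight_one_eq]
  have hc : Measurable fun x : ℝ => f x := hf.comp measurable_coe_real_ereal
  rw [h₁, lintegral_expWeight_zero_mul,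
    lintegral_expWeight_zero_mul]
  have := congrArg (fun m => ∫⁻ x : ℝ, f x ∂m) ha.symm
  rw [lintegral_map hc measurable_neg,
    lintegral_withDensity_eq_lintegral_mul _ (by fun_prop) hc] at this
  simpa using this

lemma isBSCMixture_dirac_top : IsBSCMixture (Measure.dirac ⊤) := by
  refine ⟨inferInstance, fun f hf => ?_⟩
  rw [lintegral_dirac' _ hf, lintegral_dirac' _ (by fun_prop)]
  simp [probZero]

lemma isBSCMixture_dirac_zero : IsBSCMixture (Measure.dirac 0) := by
  refine ⟨inferInstance, fun f hf => ?_⟩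
  rw [lintegral_dirac' _ hf, lintegral_dirac' _ (by fun_prop), neg_zero, ← add_mul]
  have := probZero_add_probZero_neg 0
  rw [neg_zero] at this
  rw [this, one_mul]

lemma IsBSCMixture.varConv {a b : Measure EReal} (ha : IsBSCMixture a) (hb : IsBSCMixture b) :
    IsBSCMixture (varConv a b) := by
  have := ha.isProbabilityMeasure
  have := hb.isProbabilityMeasure
  unfold RaptorMET.varConv
  refine isBSCMixture_of_lintegral_expWeight inferInstance ?_ fun f hf => ?_
  · rw [← lintegral_indicator_one (measurableSet_singleton _), Measure.lintegral_conv
      (measurable_one.indicator (measurableSet_singleton _)), ← lintegral_zero (μ := a)]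
    have ha' : ∀ᵐ x ∂a, x ≠ ⊥ := by rw [ae_iff]; simpa using ha.bot_null
    have hb' : ∀ᵐ x ∂b, x ≠ ⊥ := by rw [ae_iff]; simpa using hb.bot_null
    refine lintegral_congr_ae (ha'.mono fun x hx => ?_)
    rw [← lintegral_zero (μ := b)]
    refine lintegral_congr_ae (hb'.mono fun y hy => ?_)
    simp [EReal.add_eq_bot_iff, hx, hy]
  · rw [Measure.lintegral_conv (by fun_prop), Measure.lintegral_conv (by fun_prop)]
    have hm : ∀ c, Measurable fun p : EReal × EReal => expWeight c p.2 * f (p.1 + p.2) :=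
      fun c => by fun_prop
    -- Negation is not additive at opposite infinities, but there the weight vanishes.
    have hneg : ∀ x y : EReal, expWeight 0 (x + y) * f (-(x + y)) =
        expWeight 0 x * (expWeight 0 y * f (-x + -y)) := by
      intro x y
      rw [expWeight_add, mul_assoc]
      induction x with
      | bot => simp
      | top => simp
      | coe x => rw [EReal.neg_add (by simp) (by simp), sub_eq_add_neg]
    calc _ = ∫⁻ x, expWeight 0 x * ∫⁻ y, expWeight 0 y * f (-x + -y) ∂b ∂a := by
          refine lintegral_congr fun x => ?_
          simp only [hneg]
          rw [lintegral_const_mul _ (by fun_prop)]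
      _ = ∫⁻ x, expWeight 0 x * ∫⁻ y, expWeight 1 y * f (-x + y) ∂b ∂a := by
          refine lintegral_congr fun x => ?_
          rw [hb.lintegral_expWeight (f := fun y => f (-x + y)) (by fun_prop)]
      _ = ∫⁻ x, expWeight 1 x * ∫⁻ y, expWeight 1 y * f (x + y) ∂b ∂a :=
          ha.lintegral_expWeight (f := fun x => ∫⁻ y, expWeight 1 y * f (x + y) ∂b)
            (hm 1).lintegral_prod_right'
      _ = _ := by
          refine lintegral_congr fun x => ?_
          rw [← lintegral_const_mul _ (by fun_prop)]
          simp only [expWeight_add, mul_assoc]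

lemma lintegral_checkConv {a b : Measure EReal} [SFinite b] {f : EReal → ℝ≥0∞}
    (hf : Measurable f) : ∫⁻ z, f z ∂(checkConv a b) = ∫⁻ x, ∫⁻ y, f (boxPlus x y) ∂b ∂a := by
  rw [checkConv, lintegral_map hf measurable_boxPlus,
    lintegral_prod (fun p : EReal × EReal => f (boxPlus p.1 p.2))
      (hf.comp measurable_boxPlus).aemeasurable]

/-- The check rule is odd in each argument, so redrawing both input signs independently redraws the
output sign; `probZero_boxPlus` says that it does so with the right posterior. -/
lemma IsBSCMixture.checkConv {a b : Measure EReal} (ha : IsBSCMixture a) (hb : IsBSCMixture b) :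
    IsBSCMixture (checkConv a b) := by
  have := ha.isProbabilityMeasure
  have := hb.isProbabilityMeasure
  refine ⟨Measure.isProbabilityMeasure_map measurable_boxPlus.aemeasurable, fun f hf => ?_⟩
  have hm : Measurable fun p : EReal × EReal => f (boxPlus p.1 p.2) :=
    hf.comp measurable_boxPlus
  rw [lintegral_checkConv hf, lintegral_checkConv (by fun_prop),
    ha.lintegral_eq (fun x => ∫⁻ y, f (boxPlus x y) ∂b) hm.lintegral_prod_right']
  refine lintegral_congr fun x => ?_
  rw [hb.lintegral_eq (fun y => f (boxPlus x y)) (by fun_prop),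
    hb.lintegral_eq (fun y => f (boxPlus (-x) y)) (by fun_prop)]
  simp only [boxPlus_neg_left, boxPlus_neg_right, neg_neg]
  rw [← lintegral_const_mul _ (by fun_prop), ← lintegral_const_mul _ (by fun_prop),
    ← lintegral_add_left (by fun_prop)]
  refine lintegral_congr fun y => ?_
  rw [← boxPlus_neg_left, probZero_boxPlus, probZero_boxPlus, neg_neg, boxPlus_neg_left]
  ring

lemma IsBSCMixture.varPow {a : Measure EReal} (ha : IsBSCMixture a) (n : ℕ) :
    IsBSCMixture (varPow a n) := by
  induction n with
  | zero => exact isBSCMixture_dirac_zero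
  | succ n ih => exact ha.varConv ih

lemma IsBSCMixture.checkPow {a : Measure EReal} (ha : IsBSCMixture a) (n : ℕ) :
    IsBSCMixture (checkPow a n) := by
  induction n with
  | zero => exact isBSCMixture_dirac_top
  | succ n ih => exact ha.checkConv ih

lemma lintegral_sum_smul {ι : Type*} (s : Finset ι) (c : ι → ℝ≥0) (a : ι → Measure EReal)
    (f : EReal → ℝ≥0∞) :
    ∫⁻ x, f x ∂(∑ i ∈ s, c i • a i) = ∑ i ∈ s, (c i : ℝ≥0∞) * ∫⁻ x, f x ∂(a i) := by
  rw [lintegral_finsetSum_measure]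
  refine Finset.sum_congr rfl fun i _ => ?_
  rw [lintegral_smul_measure]
  rfl

lemma isBSCMixture_sum_smul {ι : Type*} {s : Finset ι} {c : ι → ℝ≥0} {a : ι → Measure EReal}
    (hc : ∑ i ∈ s, c i = 1) (ha : ∀ i ∈ s, IsBSCMixture (a i)) :
    IsBSCMixture (∑ i ∈ s, c i • a i) := by
  refine ⟨⟨?_⟩, fun f hf => ?_⟩
  · rw [← lintegral_one, lintegral_sum_smul]
    calc _ = ∑ i ∈ s, (c i : ℝ≥0∞) := Finset.sum_congr rfl fun i hi => by
          have := (ha i hi).isProbabilityMeasure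
          simp
      _ = 1 := by rw [← ENNReal.ofNNReal_finsetSum, hc, ENNReal.coe_one]
  · rw [lintegral_sum_smul, lintegral_sum_smul]
    exact Finset.sum_congr rfl fun i hi => by rw [(ha i hi).lintegral_eq f hf]

/-- The variance is twice the mean, so the Gaussian exponents at `-x` and `x` differ by exactly
`-x`. -/
lemma lintegral_channelLLR_neg {σ : ℝ} (hσ : 0 < σ) {f : ℝ → ℝ≥0∞} (hf : Measurable f) :
    ∫⁻ x, f (-x) ∂(channelLLR σ) = ∫⁻ x, ENNReal.ofReal (Real.exp (-x)) * f x ∂(channelLLR σ) := by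
  have hv : (4 / σ ^ 2).toNNReal ≠ 0 := by
    rw [Ne, Real.toNNReal_eq_zero, not_le]; positivity
  rw [← lintegral_map hf measurable_neg, channelLLR, gaussianReal_map_neg,
    gaussianReal_of_var_ne_zero _ hv, gaussianReal_of_var_ne_zero _ hv,
    lintegral_withDensity_eq_lintegral_mul _ (measurable_gaussianPDF _ _) hf,
    lintegral_withDensity_eq_lintegral_mul _ (measurable_gaussianPDF _ _) (by fun_prop)]
  refine lintegral_congr fun x => ?_
  simp only [Pi.mul_apply]
  rw [← mul_assoc]
  congr 1
  rw [gaussianPDF, gaussianPDF, ← ENNReal.ofReal_mul (gaussianPDFReal_nonneg _ _ _)]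
  congr 1
  rw [gaussianPDFReal, gaussianPDFReal, mul_assoc _ (Real.exp _), ← Real.exp_add,
    Real.coe_toNNReal _ (by positivity)]
  congr 2
  field_simp
  ring

lemma isBSCMixture_channel {σ : ℝ} (hσ : 0 < σ) : IsBSCMixture (channel σ) := by
  have : IsProbabilityMeasure (channelLLR σ) := by unfold channelLLR; infer_instance
  have hc := measurable_coe_real_ereal
  refine isBSCMixture_of_lintegral_expWeight (Measure.isProbabilityMeasure_map hc.aemeasurable) ?_
    fun f hf => ?_
  · rw [channel, Measure.map_apply hc (measurableSet_singleton _)]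
    have : Real.toEReal ⁻¹' {⊥} = ∅ := Set.eq_empty_of_forall_notMem fun x => EReal.coe_ne_bot x
    rw [this, measure_empty]
  · rw [channel, lintegral_map (by fun_prop) hc, lintegral_map (by fun_prop) hc]
    simpa using lintegral_channelLLR_neg hσ (hf.comp hc)

/-! ### The Bhattacharyya functional -/

/-- The Bhattacharyya functional `∫ exp (-x / 2) a(dx)`, where infinite messages count `0`. -/
def bhattacharyya (a : Measure EReal) : ℝ := (∫⁻ x, expWeight (1 / 2) x ∂a).toReal

/-- `√(1 - tanh (x / 2) ^ 2)`, the Bhattacharyya constant of the binary symmetric channel with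
log-likelihood ratios `x` and `-x`. -/
def bscBhattacharyya (x : EReal) : ℝ := √(1 - tanhHalf x ^ 2)

lemma one_sub_tanhHalf_sq_nonneg (x : EReal) : 0 ≤ 1 - tanhHalf x ^ 2 :=
  sub_nonneg.2 ((sq_le_one_iff_abs_le_one _).2 (abs_tanhHalf_le_one x))

lemma bscBhattacharyya_nonneg (x : EReal) : 0 ≤ bscBhattacharyya x := Real.sqrt_nonneg _

lemma bscBhattacharyya_le_one (x : EReal) : bscBhattacharyya x ≤ 1 :=
  Real.sqrt_le_one.2 (by linarith [sq_nonneg (tanhHalf x)])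

@[fun_prop] lemma measurable_bscBhattacharyya : Measurable bscBhattacharyya :=
  ((measurable_tanhHalf.pow_const 2).const_sub 1).sqrt

/-- With `s`, `t` the two values of `tanhHalf`, `1 - s²t² = (1 - s²) + (1 - t²) - (1 - s²)(1 - t²)`,
and the square root is subadditive. -/
lemma bscBhattacharyya_boxPlus_le (x y : EReal) :
    bscBhattacharyya (boxPlus x y) ≤ bscBhattacharyya x + bscBhattacharyya y := by
  have hx := bscBhattacharyya_nonneg x
  have hy := bscBhattacharyya_nonneg y
  refine Real.sqrt_le_iff.2 ⟨add_nonneg hx hy, ?_⟩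
  have h₁ : bscBhattacharyya x ^ 2 = 1 - tanhHalf x ^ 2 :=
    Real.sq_sqrt (one_sub_tanhHalf_sq_nonneg x)
  have h₂ : bscBhattacharyya y ^ 2 = 1 - tanhHalf y ^ 2 :=
    Real.sq_sqrt (one_sub_tanhHalf_sq_nonneg y)
  rw [tanhHalf_boxPlus, add_sq, h₁, h₂]
  nlinarith [mul_nonneg hx hy,
    mul_nonneg (one_sub_tanhHalf_sq_nonneg x) (one_sub_tanhHalf_sq_nonneg y)]

/-- At a finite `x`, with `y = x / 2`, the average is `cosh y - tanh y * sinh y = 1 / cosh y`. -/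
lemma probZero_mul_expWeight_half (x : EReal) :
    probZero x * expWeight (1 / 2) x + probZero (-x) * expWeight (1 / 2) (-x) =
      ENNReal.ofReal (bscBhattacharyya x) := by
  induction x with
  | bot => simp [bscBhattacharyya]
  | top => simp [bscBhattacharyya]
  | coe x =>
    rw [probZero_neg, probZero, ← EReal.coe_neg, expWeight_coe, expWeight_coe,
      ← ENNReal.ofReal_mul (half_one_add_tanhHalf_nonneg _),
      ← ENNReal.ofReal_mul (half_one_sub_tanhHalf_nonneg _),
      ← ENNReal.ofReal_add (mul_nonneg (half_one_add_tanhHalf_nonneg _) (Real.exp_pos _).le)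
        (mul_nonneg (half_one_sub_tanhHalf_nonneg _) (Real.exp_pos _).le), bscBhattacharyya,
      tanhHalf_coe]
    congr 1
    have hx : 1 / 2 * x = x / 2 := by ring
    have hx' : 1 / 2 * -x = -(x / 2) := by ring
    rw [hx, hx', neg_neg, ← Real.cosh_add_sinh (x / 2), ← Real.cosh_sub_sinh (x / 2),
      Real.tanh_eq_sinh_div_cosh]
    have hc := Real.cosh_pos (x / 2)
    have h₁ : 1 - (Real.sinh (x / 2) / Real.cosh (x / 2)) ^ 2 = (1 / Real.cosh (x / 2)) ^ 2 := by
      field_simp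
      rw [Real.cosh_sq]; ring
    rw [h₁, Real.sqrt_sq (by positivity)]
    field_simp
    linear_combination 2 * Real.cosh_sq_sub_sinh_sq (x / 2)

lemma IsBSCMixture.lintegral_expWeight_half {a : Measure EReal} (ha : IsBSCMixture a) :
    ∫⁻ x, expWeight (1 / 2) x ∂a = ∫⁻ x, ENNReal.ofReal (bscBhattacharyya x) ∂a := by
  rw [ha.lintegral_eq _ (by fun_prop)]
  exact lintegral_congr probZero_mul_expWeight_half

lemma IsBSCMixture.lintegral_expWeight_half_le_one {a : Measure EReal} (ha : IsBSCMixture a) :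
    ∫⁻ x, expWeight (1 / 2) x ∂a ≤ 1 := by
  have := ha.isProbabilityMeasure
  rw [ha.lintegral_expWeight_half, ← measure_univ (μ := a), ← lintegral_one]
  exact lintegral_mono fun x => ENNReal.ofReal_le_one.2 (bscBhattacharyya_le_one x)

lemma IsBSCMixture.ofReal_bhattacharyya {a : Measure EReal} (ha : IsBSCMixture a) :
    ENNReal.ofReal (bhattacharyya a) = ∫⁻ x, expWeight (1 / 2) x ∂a :=
  ENNReal.ofReal_toReal (ha.lintegral_expWeight_half_le_one.trans_lt ENNReal.one_lt_top).ne

lemma bhattacharyya_nonneg (a : Measure EReal) : 0 ≤ bhattacharyya a := ENNReal.toReal_nonneg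

lemma IsBSCMixture.bhattacharyya_le_one {a : Measure EReal} (ha : IsBSCMixture a) :
    bhattacharyya a ≤ 1 := by
  simpa [bhattacharyya] using ENNReal.toReal_mono ENNReal.one_ne_top
    ha.lintegral_expWeight_half_le_one

lemma bhattacharyya_varConv (a b : Measure EReal) [SFinite b] :
    bhattacharyya (varConv a b) = bhattacharyya a * bhattacharyya b := by
  rw [bhattacharyya, varConv, Measure.lintegral_conv (by fun_prop), bhattacharyya, bhattacharyya,
    ← ENNReal.toReal_mul, ← lintegral_mul_const _ (by fun_prop)]
  congr 1
  refine lintegral_congr fun x => ?_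
  rw [← lintegral_const_mul _ (by fun_prop)]
  exact lintegral_congr fun y => expWeight_add _ _ _

@[simp] lemma bhattacharyya_dirac_top : bhattacharyya (Measure.dirac ⊤) = 0 := by
  rw [bhattacharyya, lintegral_dirac]; simp

@[simp] lemma bhattacharyya_dirac_zero : bhattacharyya (Measure.dirac 0) = 1 := by
  rw [bhattacharyya, lintegral_dirac, ← EReal.coe_zero, expWeight_coe]; simp

lemma IsBSCMixture.bhattacharyya_varPow {a : Measure EReal} (ha : IsBSCMixture a) (n : ℕ) :
    bhattacharyya (RaptorMET.varPow a n) = bhattacharyya a ^ n := by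
  induction n with
  | zero => simp [RaptorMET.varPow]
  | succ n ih =>
    have := (ha.varPow n).isProbabilityMeasure
    rw [RaptorMET.varPow, bhattacharyya_varConv, ih, pow_succ']

lemma IsBSCMixture.bhattacharyya_checkConv_le {a b : Measure EReal} (ha : IsBSCMixture a)
    (hb : IsBSCMixture b) :
    bhattacharyya (RaptorMET.checkConv a b) ≤ bhattacharyya a + bhattacharyya b := by
  have := ha.isProbabilityMeasure
  have := hb.isProbabilityMeasure
  rw [← ENNReal.ofReal_le_ofReal_iff (add_nonneg (bhattacharyya_nonneg a) (bhattacharyya_nonneg b)),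
    ENNReal.ofReal_add (bhattacharyya_nonneg a) (bhattacharyya_nonneg b),
    (ha.checkConv hb).ofReal_bhattacharyya, ha.ofReal_bhattacharyya, hb.ofReal_bhattacharyya,
    (ha.checkConv hb).lintegral_expWeight_half, ha.lintegral_expWeight_half,
    hb.lintegral_expWeight_half, lintegral_checkConv (by fun_prop)]
  calc _ ≤ ∫⁻ x, ∫⁻ y, (ENNReal.ofReal (bscBhattacharyya x) +
          ENNReal.ofReal (bscBhattacharyya y)) ∂b ∂a := by
        refine lintegral_mono fun x => lintegral_mono fun y => ?_
        rw [← ENNReal.ofReal_add (bscBhattacharyya_nonneg x) (bscBhattacharyya_nonneg y)]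
        exact ENNReal.ofReal_le_ofReal (bscBhattacharyya_boxPlus_le x y)
    _ = _ := by
        simp_rw [lintegral_add_left measurable_const, lintegral_const, measure_univ, mul_one]
        rw [lintegral_add_right _ measurable_const, lintegral_const, measure_univ, mul_one]

lemma IsBSCMixture.bhattacharyya_checkPow_le {a : Measure EReal} (ha : IsBSCMixture a) (n : ℕ) :
    bhattacharyya (RaptorMET.checkPow a n) ≤ n * bhattacharyya a := by
  induction n with
  | zero => simp [RaptorMET.checkPow]
  | succ n ih =>
    refine (ha.bhattacharyya_checkConv_le (ha.checkPow n)).trans ?_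
    push_cast
    linarith

lemma bhattacharyya_sum_smul {ι : Type*} {s : Finset ι} {c : ι → ℝ≥0} {a : ι → Measure EReal}
    (ha : ∀ i ∈ s, IsBSCMixture (a i)) :
    bhattacharyya (∑ i ∈ s, c i • a i) = ∑ i ∈ s, (c i : ℝ) * bhattacharyya (a i) := by
  rw [bhattacharyya, lintegral_sum_smul, ENNReal.toReal_sum]
  · simp [bhattacharyya]
  · exact fun i hi => ENNReal.mul_ne_top ENNReal.coe_ne_top
      ((ha i hi).lintegral_expWeight_half_le_one.trans_lt ENNReal.one_lt_top).ne

lemma bhattacharyya_channel (σ : ℝ) : bhattacharyya (channel σ) = channelBhattacharyya σ := by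
  rw [bhattacharyya, channel, lintegral_map (by fun_prop) measurable_coe_real_ereal,
    channelBhattacharyya, integral_eq_lintegral_of_nonneg_ae
      (Eventually.of_forall fun x => (Real.exp_pos _).le) (by fun_prop)]
  congr 1
  refine lintegral_congr fun x => ?_
  rw [expWeight_coe]
  ring_nf

/-! ### Error probability and convergence to the error-free density -/

/-- The conditional error probability of a message `x`, before its sign is known. -/
def bscError (x : EReal) : ℝ := (1 - |tanhHalf x|) / 2

lemma bscError_nonneg (x : EReal) : 0 ≤ bscError x := by
  have := abs_tanhHalf_le_one x
  unfold bscError; linarith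

@[fun_prop] lemma measurable_bscError : Measurable bscError :=
  (measurable_tanhHalf.abs.const_sub 1).div_const 2

/-- Given the magnitude, an error means that the less likely sign was drawn. At `0` both terms
contribute, and the fair coin gives `1 / 2`. -/
lemma probZero_mul_indicator (x : EReal) :
    probZero x * ((Set.Iio 0).indicator 1 x + ({0} : Set EReal).indicator 1 x / 2) +
      probZero (-x) * ((Set.Iio 0).indicator 1 (-x) + ({0} : Set EReal).indicator 1 (-x) / 2) =
      ENNReal.ofReal (bscError x) := by
  rcases lt_trichotomy x 0 with h | h | h
  · have h' : ¬ 0 < x := h.le.not_gt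
    have ht : tanhHalf x ≤ 0 := by
      induction x with
      | bot => simp
      | top => simp at h
      | coe x =>
        rw [tanhHalf_coe, Real.tanh_eq_sinh_div_cosh]
        have : x < 0 := by exact_mod_cast h
        exact div_nonpos_of_nonpos_of_nonneg (Real.sinh_nonpos_iff.2 (by linarith))
          (Real.cosh_pos _).le
    simp [h, h', h.ne, probZero, bscError, abs_of_nonpos ht]
  · subst h
    have : tanhHalf 0 = 0 := by rw [← EReal.coe_zero, tanhHalf_coe]; simp
    simp only [neg_zero, probZero, this, bscError, add_zero, abs_zero, sub_zero]
    simp only [Set.mem_Iio, lt_self_iff_false, not_false_eq_true, Set.indicator_of_notMem,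
      Set.mem_singleton_iff, Set.indicator_of_mem, Pi.one_apply, zero_add]
    rw [← add_mul, ← ENNReal.ofReal_add (by norm_num) (by norm_num),
      ENNReal.ofReal_div_of_pos two_pos]
    norm_num
  · have h' : ¬ x < 0 := h.le.not_gt
    have ht : 0 ≤ tanhHalf x := by
      induction x with
      | bot => simp at h
      | top => simp
      | coe x =>
        rw [tanhHalf_coe, Real.tanh_eq_sinh_div_cosh]
        have : 0 < x := by exact_mod_cast h
        exact div_nonneg (Real.sinh_nonneg_iff.2 (by linarith)) (Real.cosh_pos _).le
    simp [h, h', h.ne', probZero_neg, bscError, abs_of_nonneg ht]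

lemma errorProb_nonneg (a : Measure EReal) : 0 ≤ errorProb a := by
  unfold errorProb; positivity

lemma IsBSCMixture.ofReal_errorProb {a : Measure EReal} (ha : IsBSCMixture a) :
    ENNReal.ofReal (errorProb a) = ∫⁻ x, ENNReal.ofReal (bscError x) ∂a := by
  have := ha.isProbabilityMeasure
  have m₁ : Measurable ((Set.Iio (0 : EReal)).indicator (1 : EReal → ℝ≥0∞)) :=
    measurable_one.indicator measurableSet_Iio
  have m₂ : Measurable (({0} : Set EReal).indicator (1 : EReal → ℝ≥0∞)) :=
    measurable_one.indicator (measurableSet_singleton _)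
  rw [← lintegral_congr probZero_mul_indicator, ← ha.lintegral_eq (fun x =>
    (Set.Iio 0).indicator 1 x + ({0} : Set EReal).indicator 1 x / 2) (m₁.add (m₂.div_const 2)),
    lintegral_add_left m₁, lintegral_indicator_one measurableSet_Iio]
  simp_rw [div_eq_mul_inv]
  rw [lintegral_mul_const _ m₂, lintegral_indicator_one (measurableSet_singleton _), errorProb,
    ENNReal.ofReal_add measureReal_nonneg (by positivity), ofReal_measureReal,
    ENNReal.ofReal_div_of_pos two_pos, ofReal_measureReal, div_eq_mul_inv]
  simp

lemma bscError_le (x : EReal) : bscError x ≤ bscBhattacharyya x := by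
  have h₀ := abs_nonneg (tanhHalf x)
  have h₁ := abs_tanhHalf_le_one x
  refine Real.le_sqrt_of_sq_le ?_
  rw [bscError, ← sq_abs (tanhHalf x)]
  nlinarith

/-- With `e = bscError x`, the left side is `2√(e(1 - e)) ≤ 2√e`, and AM-GM gives the rest. A bound
linear in `e` integrates directly, without Jensen's inequality. -/
lemma bscBhattacharyya_le {δ : ℝ} (hδ : 0 < δ) (x : EReal) :
    bscBhattacharyya x ≤ δ / 2 + 2 / δ * bscError x := by
  have h₀ := abs_nonneg (tanhHalf x)
  have h₁ := abs_tanhHalf_le_one x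
  have h₂ := bscError_nonneg x
  refine Real.sqrt_le_iff.2 ⟨by positivity, ?_⟩
  have h₃ : |tanhHalf x| = 1 - 2 * bscError x := by unfold bscError; ring
  rw [← sq_abs (tanhHalf x), h₃]
  have : (δ / 2 + 2 / δ * bscError x) ^ 2 =
      (δ / 2 - 2 / δ * bscError x) ^ 2 + 4 * bscError x := by field_simp; ring
  nlinarith [sq_nonneg (δ / 2 - 2 / δ * bscError x), sq_nonneg (bscError x)]

lemma IsBSCMixture.errorProb_le {a : Measure EReal} (ha : IsBSCMixture a) :
    errorProb a ≤ bhattacharyya a := by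
  rw [← ENNReal.ofReal_le_ofReal_iff (bhattacharyya_nonneg a), ha.ofReal_errorProb,
    ha.ofReal_bhattacharyya, ha.lintegral_expWeight_half]
  exact lintegral_mono fun x => ENNReal.ofReal_le_ofReal (bscError_le x)

lemma IsBSCMixture.bhattacharyya_le {a : Measure EReal} (ha : IsBSCMixture a) {δ : ℝ}
    (hδ : 0 < δ) : bhattacharyya a ≤ δ / 2 + 2 / δ * errorProb a := by
  have := ha.isProbabilityMeasure
  have he := errorProb_nonneg a
  rw [← ENNReal.ofReal_le_ofReal_iff (by positivity), ENNReal.ofReal_add (by positivity)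
    (by positivity), ENNReal.ofReal_mul (p := 2 / δ) (by positivity), ha.ofReal_errorProb,
    ha.ofReal_bhattacharyya, ha.lintegral_expWeight_half, ← lintegral_const_mul _ (by fun_prop)]
  calc _ ≤ ∫⁻ x, (ENNReal.ofReal (δ / 2) +
          ENNReal.ofReal (2 / δ) * ENNReal.ofReal (bscError x)) ∂a := by
        refine lintegral_mono fun x => ?_
        rw [← ENNReal.ofReal_mul (by positivity), ← ENNReal.ofReal_add (by positivity)
          (mul_nonneg (by positivity) (bscError_nonneg x))]
        exact ENNReal.ofReal_le_ofReal (bscBhattacharyya_le hδ x)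
    _ = _ := by rw [lintegral_add_left measurable_const]; simp

lemma IsBSCMixture.bhattacharyya_le_of_errorProb_le {a : Measure EReal} (ha : IsBSCMixture a)
    {δ : ℝ} (hδ : 0 < δ) (h : errorProb a ≤ δ ^ 2 / 4) : bhattacharyya a ≤ δ := by
  refine (ha.bhattacharyya_le hδ).trans ?_
  have : 2 / δ * errorProb a ≤ 2 / δ * (δ ^ 2 / 4) := by gcongr
  have h₂ : 2 / δ * (δ ^ 2 / 4) = δ / 2 := by field_simp; norm_num
  linarith

/-- Markov's inequality for `exp (-x / 2)`. The point `⊥` must be null, since it lies in the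
interval but has weight `0`. -/
lemma IsBSCMixture.measureReal_Iic_le {a : Measure EReal} (ha : IsBSCMixture a) (M : ℝ) :
    a.real (Set.Iic (M : EReal)) ≤ Real.exp (M / 2) * bhattacharyya a := by
  have := ha.isProbabilityMeasure
  have hb : ∀ᵐ x ∂a, x ≠ ⊥ := by rw [ae_iff]; simpa using ha.bot_null
  rw [← ENNReal.ofReal_le_ofReal_iff (mul_nonneg (Real.exp_pos _).le (bhattacharyya_nonneg a)),
    ENNReal.ofReal_mul (Real.exp_pos _).le, ha.ofReal_bhattacharyya, ofReal_measureReal,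
    ← lintegral_indicator_one measurableSet_Iic, ← lintegral_const_mul _ (by fun_prop)]
  refine lintegral_mono_ae (hb.mono fun x hx => ?_)
  induction x with
  | bot => exact absurd rfl hx
  | top => simp
  | coe x =>
    rw [expWeight_coe, ← ENNReal.ofReal_mul (Real.exp_pos _).le, ← Real.exp_add]
    by_cases h : x ≤ M
    · have : (x : EReal) ∈ Set.Iic (M : EReal) := by simpa using h
      rw [Set.indicator_of_mem this, Pi.one_apply, ENNReal.one_le_ofReal, Real.one_le_exp_iff]
      linarith
    · have : (x : EReal) ∉ Set.Iic (M : EReal) := by simpa using h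
      rw [Set.indicator_of_notMem this]
      exact zero_le

/-- A neighbourhood of `⊤` contains some `(M, ⊤]`, and the mass outside it vanishes by
`IsBSCMixture.measureReal_Iic_le`. -/
lemma weaklyTendsto_dirac_top {a : ℕ → Measure EReal} (ha : ∀ n, IsBSCMixture (a n))
    (h : Tendsto (fun n => bhattacharyya (a n)) atTop (𝓝 0)) :
    WeaklyTendsto a (Measure.dirac ⊤) := by
  intro f
  rw [integral_dirac]
  refine Metric.tendsto_atTop.2 fun ε hε => ?_
  have hnear : {x | dist (f x) (f ⊤) < ε / 2} ∈ 𝓝 (⊤ : EReal) :=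
    f.continuous.continuousAt (Metric.ball_mem_nhds _ (half_pos hε))
  obtain ⟨M, hM⟩ := EReal.mem_nhds_top_iff.1 hnear
  set K : ℝ := 2 * ‖f‖ with hK
  have hK₀ : 0 ≤ K := by positivity
  have hlim : Tendsto (fun n => K * (Real.exp (M / 2) * bhattacharyya (a n))) atTop (𝓝 0) := by
    simpa using (h.const_mul (Real.exp (M / 2))).const_mul K
  obtain ⟨N, hN⟩ := eventually_atTop.1 (hlim.eventually (gt_mem_nhds (half_pos hε)))
  refine ⟨N, fun n hn => ?_⟩
  have := (ha n).isProbabilityMeasure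
  have hpt : ∀ x, ‖f x - f ⊤‖ ≤ ε / 2 + (Set.Iic (M : EReal)).indicator (fun _ => K) x := by
    intro x
    by_cases hx : x ∈ Set.Iic (M : EReal)
    · rw [Set.indicator_of_mem hx, hK, ← dist_eq_norm]
      linarith [f.dist_le_two_norm x ⊤]
    · rw [Set.indicator_of_notMem hx, add_zero, ← dist_eq_norm]
      exact (hM (Set.mem_Ioi.2 (lt_of_not_ge (by simpa using hx))) : dist (f x) (f ⊤) < ε / 2).le
  have hi : Integrable ((Set.Iic (M : EReal)).indicator fun _ => K) (a n) :=
    (integrable_const K).indicator measurableSet_Iic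
  calc dist (∫ x, f x ∂(a n)) (f ⊤) = ‖∫ x, (f x - f ⊤) ∂(a n)‖ := by
        rw [integral_sub (f.integrable _) (integrable_const _), integral_const, dist_eq_norm]
        simp
    _ ≤ ∫ x, (ε / 2 + (Set.Iic (M : EReal)).indicator (fun _ => K) x) ∂(a n) :=
        norm_integral_le_of_norm_le ((integrable_const _).add hi) (Eventually.of_forall hpt)
    _ = ε / 2 + (a n).real (Set.Iic (M : EReal)) * K := by
        rw [integral_add (integrable_const _) hi, integral_indicator_const _ measurableSet_Iic]
        simp
    _ ≤ ε / 2 + K * (Real.exp (M / 2) * bhattacharyya (a n)) := by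
        rw [mul_comm K]
        gcongr
        exact (ha n).measureReal_Iic_le M
    _ < ε := by linarith [hN n hn]

lemma varConv_dirac_top {b : Measure EReal} (hb : IsBSCMixture b) :
    varConv (Measure.dirac ⊤) b = Measure.dirac ⊤ := by
  have := hb.isProbabilityMeasure
  rw [varConv, Measure.conv, Measure.dirac_prod, Measure.map_map (by fun_prop) (by fun_prop)]
  -- Needed because `⊤ + ⊥ = ⊥`: an error-free message absorbs everything except `⊥`.
  have hne : ∀ᵐ x ∂b, x ≠ ⊥ := by rw [ae_iff]; simpa using hb.bot_null
  have h : (fun p : EReal × EReal => p.1 + p.2) ∘ Prod.mk ⊤ =ᵐ[b] fun _ => (⊤ : EReal) :=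
    hne.mono fun x hx => EReal.top_add_of_ne_bot hx
  rw [Measure.map_congr h, Measure.map_const, measure_univ, one_smul]

lemma checkPow_dirac_top (n : ℕ) : checkPow (Measure.dirac ⊤) n = Measure.dirac ⊤ := by
  induction n with
  | zero => rfl
  | succ n ih =>
    rw [checkPow, ih, checkConv, Measure.dirac_prod_dirac, Measure.map_dirac' measurable_boxPlus]
    congr 1
    simp [boxPlus, twoArtanh]

lemma varPow_dirac_top {n : ℕ} (hn : n ≠ 0) :
    varPow (Measure.dirac ⊤) n = Measure.dirac ⊤ := by
  obtain ⟨n, rfl⟩ := Nat.exists_eq_succ_of_ne_zero hn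
  exact varConv_dirac_top (isBSCMixture_dirac_top.varPow n)

lemma sum_smul_eq_of_sum_eq_one {ι : Type*} {s : Finset ι} {c : ι → ℝ≥0}
    (hc : ∑ i ∈ s, c i = 1) {a : ι → Measure EReal} {b : Measure EReal}
    (h : ∀ i ∈ s, a i = b) : ∑ i ∈ s, c i • a i = b := by
  rw [Finset.sum_congr rfl fun i hi => by rw [h i hi], ← Finset.sum_smul, hc, one_smul]

namespace Ensemble

variable (C : Ensemble)

/-! ### Normalization of the edge degree distributions -/

/-- All degrees are at least `1` and `Ω` has total mass `1`. Through the socket equalities this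
makes every normalizing denominator of the edge fractions nonzero. -/
lemma sum_LT_sockets_ne_zero : ∑ j ∈ Icc 1 C.jcMax, (j : ℝ≥0) * C.Ω j ≠ 0 := by
  intro h
  have hΩ : ∑ j ∈ Icc 1 C.jcMax, C.Ω j = 0 := by
    refine Finset.sum_eq_zero fun j hj => ?_
    have := (Finset.sum_eq_zero_iff.1 h) j hj
    rcases mul_eq_zero.1 this with h₀ | h₀
    · have := (mem_Icc.1 hj).1
      rw [Nat.cast_eq_zero] at h₀
      omega
    · exact h₀
  exact one_ne_zero (C.sum_Ω.symm.trans hΩ)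

lemma sum_input_LT_sockets_ne_zero :
    ∑ i ∈ Icc 2 C.ivMax, ∑ j ∈ Icc 1 C.jvMax, (j : ℝ≥0) * C.L i j ≠ 0 :=
  C.socket₂.trans_ne C.sum_LT_sockets_ne_zero

lemma sum_input_precode_sockets_ne_zero :
    ∑ i ∈ Icc 2 C.ivMax, ∑ j ∈ Icc 1 C.jvMax, (i : ℝ≥0) * C.L i j ≠ 0 := by
  intro h
  refine C.sum_input_LT_sockets_ne_zero
    (Finset.sum_eq_zero fun i hi => Finset.sum_eq_zero fun j hj => ?_)
  have := Finset.sum_eq_zero_iff.1 (Finset.sum_eq_zero_iff.1 h i hi) j hj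
  rcases mul_eq_zero.1 this with h₀ | h₀
  · have := (mem_Icc.1 hi).1
    rw [Nat.cast_eq_zero] at h₀
    omega
  · rw [h₀, mul_zero]

/-- The pairs of degrees of the input bit nodes. -/
def inputDegrees : Finset (ℕ × ℕ) := Icc 2 C.ivMax ×ˢ Icc 1 C.jvMax

lemma two_le_of_mem_inputDegrees {p : ℕ × ℕ} (hp : p ∈ C.inputDegrees) : 2 ≤ p.1 :=
  (mem_Icc.1 (mem_product.1 hp).1).1

lemma sum_lam : ∑ p ∈ C.inputDegrees, C.lam p.1 p.2 = 1 := by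
  rw [inputDegrees, Finset.sum_product]
  simp only [lam, ← Finset.sum_div]
  exact div_self C.sum_input_precode_sockets_ne_zero

lemma sum_lamLT : ∑ p ∈ C.inputDegrees, C.lamLT p.1 p.2 = 1 := by
  rw [inputDegrees, Finset.sum_product]
  simp only [lamLT, ← Finset.sum_div]
  exact div_self C.sum_input_LT_sockets_ne_zero

lemma sum_rho : ∑ i ∈ Icc 1 C.icMax, C.rho i = 1 := by
  simp only [rho, ← Finset.sum_div]
  exact div_self (C.socket₁ ▸ C.sum_input_precode_sockets_ne_zero)

lemma sum_rhoLT : ∑ j ∈ Icc 1 C.jcMax, C.rhoLT j = 1 := by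
  simp only [rhoLT, ← Finset.sum_div]
  exact div_self C.sum_LT_sockets_ne_zero

lemma varOut₁_eq (b₁ b₂ : Measure EReal) : C.varOut₁ b₁ b₂ = ∑ p ∈ C.inputDegrees,
    C.lam p.1 p.2 • varConv (varPow b₁ (p.1 - 1)) (varPow b₂ p.2) := by
  rw [inputDegrees, Finset.sum_product, varOut₁]

lemma varOut₂_eq (b₁ b₂ : Measure EReal) : C.varOut₂ b₁ b₂ = ∑ p ∈ C.inputDegrees,
    C.lamLT p.1 p.2 • varConv (varPow b₁ p.1) (varPow b₂ (p.2 - 1)) := by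
  rw [inputDegrees, Finset.sum_product, varOut₂]

/-! ### Density evolution preserves symmetry -/

/-- Both densities of a state are symmetric. -/
def IsSymmetricState (s : Measure EReal × Measure EReal) : Prop :=
  IsBSCMixture s.1 ∧ IsBSCMixture s.2

variable {C} {σ : ℝ} {s : Measure EReal × Measure EReal}

lemma isBSCMixture_checkOut₁ (hs : IsSymmetricState s) : IsBSCMixture (C.checkOut₁ s) :=
  isBSCMixture_sum_smul C.sum_rho fun _ _ => hs.1.checkPow _

lemma isBSCMixture_sum_rhoLT (hs : IsSymmetricState s) :
    IsBSCMixture (∑ j ∈ Icc 1 C.jcMax, C.rhoLT j • checkPow s.2 (j - 1)) :=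
  isBSCMixture_sum_smul C.sum_rhoLT fun _ _ => hs.2.checkPow _

lemma isBSCMixture_checkOut₂ (hσ : 0 < σ) (hs : IsSymmetricState s) :
    IsBSCMixture (C.checkOut₂ σ s) :=
  (isBSCMixture_channel hσ).checkConv (isBSCMixture_sum_rhoLT hs)

lemma isBSCMixture_checkOut₃ (hs : IsSymmetricState s) : IsBSCMixture (C.checkOut₃ s) :=
  isBSCMixture_sum_smul C.sum_Ω fun _ _ => hs.2.checkPow _

lemma isSymmetricState_step (hσ : 0 < σ) (hs : IsSymmetricState s) :
    IsSymmetricState (C.step σ s) := by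
  have h₁ := isBSCMixture_checkOut₁ (C := C) hs
  have h₂ := isBSCMixture_checkOut₂ (C := C) hσ hs
  constructor
  · rw [step, varOut₁_eq]
    exact isBSCMixture_sum_smul C.sum_lam fun _ _ => (h₁.varPow _).varConv (h₂.varPow _)
  · rw [step, varOut₂_eq]
    exact isBSCMixture_sum_smul C.sum_lamLT fun _ _ => (h₁.varPow _).varConv (h₂.varPow _)

lemma isSymmetricState_iterate (hσ : 0 < σ) (hs : IsSymmetricState s) (n : ℕ) :
    IsSymmetricState ((C.step σ)^[n] s) := by
  induction n with
  | zero => exact hs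
  | succ n ih =>
    rw [Function.iterate_succ_apply']
    exact isSymmetricState_step hσ ih

/-- An input bit has at least two precode edges, so every outgoing message includes an error-free
incoming one, which dominates whatever the LT checks send. -/
lemma step_zeroErrorPoint (hσ : 0 < σ) : C.step σ zeroErrorPoint = zeroErrorPoint := by
  have hs : IsSymmetricState zeroErrorPoint := ⟨isBSCMixture_dirac_top, isBSCMixture_dirac_top⟩
  have h₂ := isBSCMixture_checkOut₂ (C := C) hσ hs
  have h₁ : C.checkOut₁ zeroErrorPoint = Measure.dirac ⊤ :=
    sum_smul_eq_of_sum_eq_one C.sum_rho fun i _ => checkPow_dirac_top _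
  refine Prod.ext ?_ ?_
  · rw [step, h₁, varOut₁_eq]
    refine sum_smul_eq_of_sum_eq_one C.sum_lam fun p hp => ?_
    have := C.two_le_of_mem_inputDegrees hp
    rw [varPow_dirac_top (by omega), varConv_dirac_top (h₂.varPow _)]
    rfl
  · rw [step, h₁, varOut₂_eq]
    refine sum_smul_eq_of_sum_eq_one C.sum_lamLT fun p hp => ?_
    have := C.two_le_of_mem_inputDegrees hp
    rw [varPow_dirac_top (by omega), varConv_dirac_top (h₂.varPow _)]
    rfl

/-! ### Bhattacharyya bounds for one iteration -/

lemma deriv_rhoPoly_one : deriv C.rhoPoly 1 = ∑ i ∈ Icc 1 C.icMax, (C.rho i : ℝ) * (i - 1 : ℕ) := by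
  have : HasDerivAt C.rhoPoly
      (∑ i ∈ Icc 1 C.icMax, (C.rho i : ℝ) * ((i - 1 : ℕ) * 1 ^ (i - 1 - 1))) 1 :=
    HasDerivAt.fun_sum fun i _ => (hasDerivAt_pow (i - 1) (1 : ℝ)).const_mul _
  simpa using this.deriv

lemma deriv_rhoPoly_one_nonneg : 0 ≤ deriv C.rhoPoly 1 := by
  rw [deriv_rhoPoly_one]; positivity

lemma bhattacharyya_sum_checkPow_le {t : Finset ℕ} {c : ℕ → ℝ≥0} {d : ℕ → ℕ} {a : Measure EReal}
    (ha : IsBSCMixture a) : bhattacharyya (∑ i ∈ t, c i • checkPow a (d i)) ≤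
      (∑ i ∈ t, (c i : ℝ) * d i) * bhattacharyya a := by
  rw [bhattacharyya_sum_smul fun _ _ => ha.checkPow _, Finset.sum_mul]
  refine Finset.sum_le_sum fun i _ => ?_
  rw [mul_assoc]
  exact mul_le_mul_of_nonneg_left (ha.bhattacharyya_checkPow_le _) (c i).coe_nonneg

lemma bhattacharyya_checkOut₁_le (hs : IsSymmetricState s) :
    bhattacharyya (C.checkOut₁ s) ≤ deriv C.rhoPoly 1 * bhattacharyya s.1 := by
  rw [deriv_rhoPoly_one]
  exact bhattacharyya_sum_checkPow_le hs.1

lemma bhattacharyya_checkOut₂_le (hσ : 0 < σ) (hs : IsSymmetricState s) :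
    bhattacharyya (C.checkOut₂ σ s) ≤ channelBhattacharyya σ +
      (∑ j ∈ Icc 1 C.jcMax, (C.rhoLT j : ℝ) * (j - 1 : ℕ)) * bhattacharyya s.2 := by
  rw [← bhattacharyya_channel]
  exact ((isBSCMixture_channel hσ).bhattacharyya_checkConv_le (isBSCMixture_sum_rhoLT hs)).trans
    (add_le_add_right (bhattacharyya_sum_checkPow_le hs.2) _)

lemma bhattacharyya_checkOut₃_le (hs : IsSymmetricState s) :
    bhattacharyya (C.checkOut₃ s) ≤
      (∑ j ∈ Icc 1 C.jcMax, (C.Ω j : ℝ) * j) * bhattacharyya s.2 :=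
  bhattacharyya_sum_checkPow_le hs.2

lemma bhattacharyya_varConv_varPow {b₁ b₂ : Measure EReal} (h₁ : IsBSCMixture b₁)
    (h₂ : IsBSCMixture b₂) (m n : ℕ) : bhattacharyya (varConv (varPow b₁ m) (varPow b₂ n)) =
      bhattacharyya b₁ ^ m * bhattacharyya b₂ ^ n := by
  have := (h₂.varPow n).isProbabilityMeasure
  rw [bhattacharyya_varConv, h₁.bhattacharyya_varPow, h₂.bhattacharyya_varPow]

lemma sum_mul_le_of_sum_eq_one {ι : Type*} {t : Finset ι} {c : ι → ℝ≥0} (hc : ∑ i ∈ t, c i = 1)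
    {f : ι → ℝ} {B : ℝ} (h : ∀ i ∈ t, f i ≤ B) : ∑ i ∈ t, (c i : ℝ) * f i ≤ B := by
  calc _ ≤ ∑ i ∈ t, (c i : ℝ) * B :=
        Finset.sum_le_sum fun i hi => mul_le_mul_of_nonneg_left (h i hi) (c i).coe_nonneg
    _ = B := by rw [← Finset.sum_mul, ← NNReal.coe_sum, hc, NNReal.coe_one, one_mul]

lemma pow_mul_pow_le {u v : ℝ} (hu : 0 ≤ u) (hu' : u ≤ 1) (hv : 0 ≤ v) (hv' : v ≤ 1)
    {k m : ℕ} (n : ℕ) (h : k ≤ m) : u ^ m * v ^ n ≤ u ^ k :=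
  (mul_le_of_le_one_right (by positivity) (pow_le_one₀ hv hv')).trans
    (pow_le_pow_of_le_one hu hu' h)

/-- A message on a type 2 edge uses all precode edges of its node, of which there are at least two;
hence no linear term. -/
lemma bhattacharyya_step_snd_le (hσ : 0 < σ) (hs : IsSymmetricState s) :
    bhattacharyya (C.step σ s).2 ≤ bhattacharyya (C.checkOut₁ s) ^ 2 := by
  have h₁ := isBSCMixture_checkOut₁ (C := C) hs
  have h₂ := isBSCMixture_checkOut₂ (C := C) hσ hs
  rw [step, varOut₂_eq,
    bhattacharyya_sum_smul fun _ _ => (h₁.varPow _).varConv (h₂.varPow _)]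
  refine sum_mul_le_of_sum_eq_one C.sum_lamLT fun p hp => ?_
  rw [bhattacharyya_varConv_varPow h₁ h₂]
  exact pow_mul_pow_le (bhattacharyya_nonneg _) h₁.bhattacharyya_le_one (bhattacharyya_nonneg _)
    h₂.bhattacharyya_le_one _ (C.two_le_of_mem_inputDegrees hp)

/-- A cruder bound than `bhattacharyya_step_fst_le`, for use where nothing is known about the LT
messages. -/
lemma bhattacharyya_step_fst_le_checkOut₁ (hσ : 0 < σ) (hs : IsSymmetricState s) :
    bhattacharyya (C.step σ s).1 ≤ bhattacharyya (C.checkOut₁ s) := by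
  have h₁ := isBSCMixture_checkOut₁ (C := C) hs
  have h₂ := isBSCMixture_checkOut₂ (C := C) hσ hs
  rw [step, varOut₁_eq,
    bhattacharyya_sum_smul fun _ _ => (h₁.varPow _).varConv (h₂.varPow _)]
  refine sum_mul_le_of_sum_eq_one C.sum_lam fun p hp => ?_
  rw [bhattacharyya_varConv_varPow h₁ h₂]
  have := C.two_le_of_mem_inputDegrees hp
  exact (pow_mul_pow_le (bhattacharyya_nonneg _) h₁.bhattacharyya_le_one (bhattacharyya_nonneg _)
    h₂.bhattacharyya_le_one _ (show 1 ≤ p.1 - 1 by omega)).trans_eq (pow_one _)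

lemma bhattacharyya_step_fst_le (hσ : 0 < σ) (hs : IsSymmetricState s) :
    bhattacharyya (C.step σ s).1 ≤
      (∑ j ∈ Icc 1 C.jvMax, (C.lam 2 j : ℝ) * bhattacharyya (C.checkOut₂ σ s) ^ j) *
        bhattacharyya (C.checkOut₁ s) + bhattacharyya (C.checkOut₁ s) ^ 2 := by
  have h₁ := isBSCMixture_checkOut₁ (C := C) hs
  have h₂ := isBSCMixture_checkOut₂ (C := C) hσ hs
  rw [step, varOut₁_eq,
    bhattacharyya_sum_smul fun _ _ => (h₁.varPow _).varConv (h₂.varPow _)]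
  simp only [bhattacharyya_varConv_varPow h₁ h₂]
  set u := bhattacharyya (C.checkOut₁ s)
  set v := bhattacharyya (C.checkOut₂ σ s)
  have hu : 0 ≤ u := bhattacharyya_nonneg _
  have hv : 0 ≤ v := bhattacharyya_nonneg _
  have hu' : u ≤ 1 := h₁.bhattacharyya_le_one
  have hv' : v ≤ 1 := h₂.bhattacharyya_le_one
  -- Only nodes with two precode edges give a term linear in `u`; the others have `p.1 - 1 ≥ 2`.
  have key : ∀ p ∈ C.inputDegrees, (C.lam p.1 p.2 : ℝ) * (u ^ (p.1 - 1) * v ^ p.2) ≤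
      (if p.1 = 2 then (C.lam 2 p.2 : ℝ) * v ^ p.2 * u else 0) + (C.lam p.1 p.2 : ℝ) * u ^ 2 := by
    intro p hp
    have hp₂ := C.two_le_of_mem_inputDegrees hp
    split_ifs with h
    · rw [h]
      have : 0 ≤ (C.lam 2 p.2 : ℝ) * u ^ 2 := by positivity
      norm_num
      linarith
    · rw [zero_add]
      exact mul_le_mul_of_nonneg_left (pow_mul_pow_le hu hu' hv hv' _ (by omega))
        (C.lam p.1 p.2).coe_nonneg
  refine (Finset.sum_le_sum key).trans ?_
  rw [Finset.sum_add_distrib]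
  refine add_le_add ?_ (sum_mul_le_of_sum_eq_one C.sum_lam fun _ _ => le_rfl)
  rw [inputDegrees, Finset.sum_product_right, Finset.sum_mul]
  refine Finset.sum_le_sum fun j _ => ?_
  rw [Finset.sum_ite_eq']
  -- The second case is that of an empty degree range, `C.ivMax < 2`.
  split_ifs
  · exact le_rfl
  · positivity

/-! ### Bit error rates -/

lemma inputBER_nonneg : 0 ≤ C.inputBER σ s := by
  unfold inputBER
  refine div_nonneg ?_ (by positivity)
  exact Finset.sum_nonneg fun i _ => Finset.sum_nonneg fun j _ =>
    mul_nonneg (C.L i j).coe_nonneg (errorProb_nonneg _)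

lemma inputBER_le (hσ : 0 < σ) (hs : IsSymmetricState s) :
    C.inputBER σ s ≤ deriv C.rhoPoly 1 * bhattacharyya s.1 := by
  have h₁ := isBSCMixture_checkOut₁ (C := C) hs
  have h₂ := isBSCMixture_checkOut₂ (C := C) hσ hs
  refine (div_le_of_le_mul₀ (by positivity) (bhattacharyya_nonneg (C.checkOut₁ s)) ?_).trans
    (bhattacharyya_checkOut₁_le hs)
  rw [Finset.mul_sum]
  refine Finset.sum_le_sum fun i hi => ?_
  rw [Finset.mul_sum]
  refine Finset.sum_le_sum fun j _ => ?_
  rw [mul_comm]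
  refine mul_le_mul_of_nonneg_right ?_ (C.L i j).coe_nonneg
  refine ((h₁.varPow i).varConv (h₂.varPow j)).errorProb_le.trans ?_
  rw [bhattacharyya_varConv_varPow h₁ h₂]
  have := (mem_Icc.1 hi).1
  exact (pow_mul_pow_le (bhattacharyya_nonneg _) h₁.bhattacharyya_le_one (bhattacharyya_nonneg _)
    h₂.bhattacharyya_le_one _ (show 1 ≤ i by omega)).trans_eq (pow_one _)

lemma outputBER_nonneg : 0 ≤ C.outputBER σ s := errorProb_nonneg _

lemma outputBER_le (hσ : 0 < σ) (hs : IsSymmetricState s) :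
    C.outputBER σ s ≤ (∑ j ∈ Icc 1 C.jcMax, (C.Ω j : ℝ) * j) * bhattacharyya s.2 := by
  have h₀ := isBSCMixture_channel hσ
  have h₃ := isBSCMixture_checkOut₃ (C := C) hs
  have := h₃.isProbabilityMeasure
  refine (h₀.varConv h₃).errorProb_le.trans ((bhattacharyya_varConv _ _).trans_le ?_)
  exact (mul_le_of_le_one_left (bhattacharyya_nonneg _) h₀.bhattacharyya_le_one).trans
    (bhattacharyya_checkOut₃_le hs)

lemma tendsto_inputBER (hσ : 0 < σ) {s : ℕ → Measure EReal × Measure EReal}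
    (hs : ∀ n, IsSymmetricState (s n))
    (h : Tendsto (fun n => bhattacharyya (s n).1) atTop (𝓝 0)) :
    Tendsto (fun n => C.inputBER σ (s n)) atTop (𝓝 0) :=
  squeeze_zero (fun _ => inputBER_nonneg) (fun n => inputBER_le hσ (hs n))
    (by simpa using h.const_mul (deriv C.rhoPoly 1))

lemma tendsto_outputBER (hσ : 0 < σ) {s : ℕ → Measure EReal × Measure EReal}
    (hs : ∀ n, IsSymmetricState (s n))
    (h : Tendsto (fun n => bhattacharyya (s n).2) atTop (𝓝 0)) :
    Tendsto (fun n => C.outputBER σ (s n)) atTop (𝓝 0) :=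
  squeeze_zero (fun _ => outputBER_nonneg) (fun n => outputBER_le hσ (hs n))
    (by simpa using h.const_mul (∑ j ∈ Icc 1 C.jcMax, (C.Ω j : ℝ) * j))

/-! ### Contraction near the zero-error point -/

lemma exists_contraction (hσ : 0 < σ)
    (h : (∑ j ∈ Icc 1 C.jvMax, (C.lam 2 j : ℝ) * channelBhattacharyya σ ^ j) *
      deriv C.rhoPoly 1 < 1) :
    ∃ η q : ℝ, 0 < η ∧ 0 ≤ q ∧ q < 1 ∧ ∀ s : Measure EReal × Measure EReal,
      IsSymmetricState s → bhattacharyya s.1 ≤ η → bhattacharyya s.2 ≤ η →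
        bhattacharyya (C.step σ s).1 ≤ q * bhattacharyya s.1 ∧
        bhattacharyya (C.step σ s).2 ≤ q * bhattacharyya s.1 := by
  set r := deriv C.rhoPoly 1 with hr
  have hr₀ : 0 ≤ r := deriv_rhoPoly_one_nonneg
  set M := ∑ j ∈ Icc 1 C.jcMax, (C.rhoLT j : ℝ) * (j - 1 : ℕ) with hM
  have hM₀ : 0 ≤ M := by positivity
  have hx₀ : 0 ≤ channelBhattacharyya σ := bhattacharyya_channel σ ▸ bhattacharyya_nonneg _
  -- `G η` is the contraction factor on states with both functionals at most `η`. `G 0` is the left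
  -- side of the stability condition, so continuity gives `G η < 1` for some `η > 0`.
  let G : ℝ → ℝ := fun η =>
    (∑ j ∈ Icc 1 C.jvMax, (C.lam 2 j : ℝ) * (channelBhattacharyya σ + M * η) ^ j) * r + r ^ 2 * η
  have hG : Continuous G := by fun_prop
  have hG₀ : G 0 < 1 := by simpa [G] using h
  obtain ⟨η, hη₁, hη₀⟩ := ((hG.tendsto 0).eventually (gt_mem_nhds hG₀)
    |>.filter_mono nhdsWithin_le_nhds |>.and self_mem_nhdsWithin : ∀ᶠ η in 𝓝[>] (0 : ℝ),
      G η < 1 ∧ η ∈ Set.Ioi (0 : ℝ)).exists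
  have hη : 0 < η := hη₀
  have hF : 0 ≤ (∑ j ∈ Icc 1 C.jvMax,
      (C.lam 2 j : ℝ) * (channelBhattacharyya σ + M * η) ^ j) * r := by positivity
  refine ⟨η, G η, hη, add_nonneg hF (by positivity), hη₁, fun s hs hx hy => ?_⟩
  have hx' := bhattacharyya_nonneg s.1
  have hu₀ := bhattacharyya_nonneg (C.checkOut₁ s)
  have hv₀ := bhattacharyya_nonneg (C.checkOut₂ σ s)
  have hu := bhattacharyya_checkOut₁_le (C := C) hs
  have hv : bhattacharyya (C.checkOut₂ σ s) ≤ channelBhattacharyya σ + M * η :=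
    (bhattacharyya_checkOut₂_le hσ hs).trans (by gcongr)
  rw [← hr] at hu
  have hu₂ : bhattacharyya (C.checkOut₁ s) ^ 2 ≤ r ^ 2 * η * bhattacharyya s.1 := by
    calc _ ≤ (r * bhattacharyya s.1) ^ 2 := by gcongr
      -- One factor of the quadratic term is bounded by `η`, the other kept.
      _ = r ^ 2 * bhattacharyya s.1 * bhattacharyya s.1 := by ring
      _ ≤ _ := by gcongr
  constructor
  · refine (bhattacharyya_step_fst_le hσ hs).trans ?_
    simp only [G, add_mul]
    refine add_le_add ?_ hu₂
    rw [mul_assoc]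
    gcongr
  · refine (bhattacharyya_step_snd_le hσ hs).trans ?_
    simp only [G, add_mul]
    exact le_add_of_nonneg_of_le (mul_nonneg hF hx') hu₂

lemma bhattacharyya_iterate_le (hσ : 0 < σ) {η q δ : ℝ} (hq : 0 ≤ q) (hq' : q < 1) (hδη : δ ≤ η)
    (hstep : ∀ s : Measure EReal × Measure EReal,
      IsSymmetricState s → bhattacharyya s.1 ≤ η → bhattacharyya s.2 ≤ η →
        bhattacharyya (C.step σ s).1 ≤ q * bhattacharyya s.1 ∧
        bhattacharyya (C.step σ s).2 ≤ q * bhattacharyya s.1)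
    (hs : IsSymmetricState s) (h₁ : bhattacharyya s.1 ≤ δ) (h₂ : bhattacharyya s.2 ≤ δ) (n : ℕ) :
    bhattacharyya ((C.step σ)^[n] s).1 ≤ q ^ n * δ ∧
      bhattacharyya ((C.step σ)^[n] s).2 ≤ q ^ n * δ := by
  have hδ : 0 ≤ δ := (bhattacharyya_nonneg _).trans h₁
  induction n with
  | zero => simpa using ⟨h₁, h₂⟩
  | succ n ih =>
    have hle : q ^ n * δ ≤ η := (mul_le_of_le_one_left hδ (pow_le_one₀ hq hq'.le)).trans hδη
    have := hstep _ (isSymmetricState_iterate hσ hs n) (ih.1.trans hle) (ih.2.trans hle)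
    rw [Function.iterate_succ_apply', pow_succ', mul_assoc]
    exact ⟨this.1.trans (by gcongr; exact ih.1), this.2.trans (by gcongr; exact ih.1)⟩

/-- A neighbourhood of the zero-error point, in terms of the Bhattacharyya functional, from which
density evolution converges to it without leaving smaller neighbourhoods. -/
lemma exists_bhattacharyya_basin (hσ : 0 < σ)
    (h : (∑ j ∈ Icc 1 C.jvMax, (C.lam 2 j : ℝ) * channelBhattacharyya σ ^ j) *
      deriv C.rhoPoly 1 < 1) :
    ∃ η : ℝ, 0 < η ∧ ∀ δ ≤ η, ∀ s : Measure EReal × Measure EReal,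
      IsSymmetricState s → bhattacharyya s.1 ≤ δ → bhattacharyya s.2 ≤ δ →
        (∀ n, bhattacharyya ((C.step σ)^[n] s).1 ≤ δ ∧ bhattacharyya ((C.step σ)^[n] s).2 ≤ δ) ∧
        Tendsto (fun n => bhattacharyya ((C.step σ)^[n] s).1) atTop (𝓝 0) ∧
        Tendsto (fun n => bhattacharyya ((C.step σ)^[n] s).2) atTop (𝓝 0) := by
  obtain ⟨η, q, hη, hq, hq', hstep⟩ := exists_contraction hσ h
  refine ⟨η, hη, fun δ hδη s hs h₁ h₂ => ?_⟩
  have hδ : 0 ≤ δ := (bhattacharyya_nonneg _).trans h₁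
  have key := bhattacharyya_iterate_le hσ hq hq' hδη hstep hs h₁ h₂
  have hle : ∀ n, q ^ n * δ ≤ δ := fun n => mul_le_of_le_one_left hδ (pow_le_one₀ hq hq'.le)
  have hlim : Tendsto (fun n => q ^ n * δ) atTop (𝓝 0) := by
    simpa using (tendsto_pow_atTop_nhds_zero_of_lt_one hq hq').mul_const δ
  exact ⟨fun n => ⟨(key n).1.trans (hle n), (key n).2.trans (hle n)⟩,
    squeeze_zero (fun _ => bhattacharyya_nonneg _) (fun n => (key n).1) hlim,
    squeeze_zero (fun _ => bhattacharyya_nonneg _) (fun n => (key n).2) hlim⟩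

/-! ### Stability and the threshold of the joint decoder -/

lemma zeroErrorStable_of_lt_one (hσ : 0 < σ)
    (h : (∑ j ∈ Icc 1 C.jvMax, (C.lam 2 j : ℝ) * channelBhattacharyya σ ^ j) *
      deriv C.rhoPoly 1 < 1) : C.ZeroErrorStable σ := by
  obtain ⟨η, hη, hbasin⟩ := exists_bhattacharyya_basin hσ h
  refine ⟨step_zeroErrorPoint hσ, fun ε hε => ?_, ?_⟩
  -- Below `η` the functionals stay under their initial bound; below `ε` they bound the error
  -- probabilities as required.
  · have hδ : 0 < min ε η := lt_min hε hη
    refine ⟨(min ε η) ^ 2 / 4, by positivity, fun s hs₁ hs₂ he₁ he₂ ℓ => ?_⟩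
    have hs : IsSymmetricState s := ⟨hs₁.isBSCMixture, hs₂.isBSCMixture⟩
    have key := (hbasin _ (min_le_right ε η) s hs (hs.1.bhattacharyya_le_of_errorProb_le hδ he₁)
      (hs.2.bhattacharyya_le_of_errorProb_le hδ he₂)).1 ℓ
    have hℓ := isSymmetricState_iterate (C := C) hσ hs ℓ
    exact ⟨hℓ.1.errorProb_le.trans (key.1.trans (min_le_left _ _)),
      hℓ.2.errorProb_le.trans (key.2.trans (min_le_left _ _))⟩
  · refine ⟨η ^ 2 / 4, by positivity, fun s hs₁ hs₂ he₁ he₂ => ?_⟩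
    have hs : IsSymmetricState s := ⟨hs₁.isBSCMixture, hs₂.isBSCMixture⟩
    obtain ⟨-, h₁, h₂⟩ := hbasin η le_rfl s hs (hs.1.bhattacharyya_le_of_errorProb_le hη he₁)
      (hs.2.bhattacharyya_le_of_errorProb_le hη he₂)
    have hℓ := isSymmetricState_iterate (C := C) hσ hs
    exact ⟨weaklyTendsto_dirac_top (fun n => (hℓ n).1) h₁,
      weaklyTendsto_dirac_top (fun n => (hℓ n).2) h₂, tendsto_inputBER hσ hℓ h₁,
      tendsto_outputBER hσ hℓ h₂⟩

lemma isSymmetricState_decoder (hσ : 0 < σ) (ℓ : ℕ) : IsSymmetricState (C.decoder σ ℓ) :=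
  isSymmetricState_iterate hσ ⟨isBSCMixture_dirac_zero, isBSCMixture_dirac_zero⟩ ℓ

/-- Smallness is assumed on type 1 only. One further iteration brings both components into the
basin, since each new functional is at most that of `checkOut₁`, whatever the LT messages are. -/
lemma exists_decoder_threshold (hσ : 0 < σ)
    (h : (∑ j ∈ Icc 1 C.jvMax, (C.lam 2 j : ℝ) * channelBhattacharyya σ ^ j) *
      deriv C.rhoPoly 1 < 1) :
    ∃ ξ : ℝ, 0 < ξ ∧ ((∃ ℓ : ℕ, errorProb (C.decoder σ ℓ).1 ≤ ξ) →
      Tendsto (fun ℓ => C.inputBER σ (C.decoder σ ℓ)) atTop (𝓝 0) ∧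
      Tendsto (fun ℓ => C.outputBER σ (C.decoder σ ℓ)) atTop (𝓝 0)) := by
  obtain ⟨η, hη, hbasin⟩ := exists_bhattacharyya_basin hσ h
  have hr : 0 ≤ deriv C.rhoPoly 1 := deriv_rhoPoly_one_nonneg
  -- The `+ 1` covers the case of zero derivative.
  set δ := η / (deriv C.rhoPoly 1 + 1) with hδ_def
  have hδ : 0 < δ := by positivity
  refine ⟨δ ^ 2 / 4, by positivity, fun ⟨ℓ, hℓ⟩ => ?_⟩
  have hsym := isSymmetricState_decoder (C := C) hσ
  have hx := (hsym ℓ).1.bhattacharyya_le_of_errorProb_le hδ hℓ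
  have hu : bhattacharyya (C.checkOut₁ (C.decoder σ ℓ)) ≤ η := by
    calc _ ≤ deriv C.rhoPoly 1 * bhattacharyya (C.decoder σ ℓ).1 :=
          bhattacharyya_checkOut₁_le (hsym ℓ)
      _ ≤ (deriv C.rhoPoly 1 + 1) * δ :=
          mul_le_mul (by linarith) hx (bhattacharyya_nonneg _) (by positivity)
      _ = η := by rw [hδ_def]; field_simp
  have h₁ := (bhattacharyya_step_fst_le_checkOut₁ hσ (hsym ℓ)).trans hu
  have h₂ := ((bhattacharyya_step_snd_le hσ (hsym ℓ)).trans
    (pow_le_of_le_one (bhattacharyya_nonneg _)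
      (isBSCMixture_checkOut₁ (hsym ℓ)).bhattacharyya_le_one two_ne_zero)).trans hu
  obtain ⟨-, t₁, t₂⟩ := hbasin η le_rfl _ (isSymmetricState_step hσ (hsym ℓ)) h₁ h₂
  -- The basin is entered at iteration `ℓ + 1`; limits do not see the shift.
  have hshift : ∀ n, (C.step σ)^[n] (C.step σ (C.decoder σ ℓ)) = C.decoder σ (n + (ℓ + 1)) := by
    intro n
    rw [decoder, decoder, ← Function.iterate_succ_apply' (C.step σ) ℓ,
      ← Function.iterate_add_apply]
  simp only [hshift] at t₁ t₂
  exact ⟨tendsto_inputBER hσ hsym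
      ((tendsto_add_atTop_iff_nat (f := fun n => bhattacharyya (C.decoder σ n).1) (ℓ + 1)).1 t₁),
    tendsto_outputBER hσ hsym
      ((tendsto_add_atTop_iff_nat (f := fun n => bhattacharyya (C.decoder σ n).2) (ℓ + 1)).1 t₂)⟩

end Ensemble

end RaptorMET

end

theorem theorem1 (C : RaptorMET.Ensemble) (σ : ℝ) (hσ : 0 < σ)
    (h : (∑ j ∈ Finset.Icc 1 C.jvMax,
        (C.lam 2 j : ℝ) * RaptorMET.channelBhattacharyya σ ^ j) * deriv C.rhoPoly 1 < 1) :
    C.ZeroErrorStable σ ∧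
      ∃ ξ : ℝ, 0 < ξ ∧ ((∃ ℓ : ℕ, RaptorMET.errorProb (C.decoder σ ℓ).1 ≤ ξ) →
        Filter.Tendsto (fun ℓ => C.inputBER σ (C.decoder σ ℓ)) Filter.atTop (nhds 0) ∧
        Filter.Tendsto (fun ℓ => C.outputBER σ (C.decoder σ ℓ)) Filter.atTop (nhds 0)) :=
  ⟨RaptorMET.Ensemble.zeroErrorStable_of_lt_one hσ h,
    RaptorMET.Ensemble.exists_decoder_threshold hσ h⟩
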